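/- Let $d\ge 1$, and let $\mathbb{Z}_n^d$ be the $d$-dimensional discrete torus. Dynamical percolation with parameters $p\in[0,1]$ and $\mu>0$ is the Markov process $\eta=(\eta_t)_{t\ge 0}$ on $\{0,1\}^{E(\mathbb{Z}_n^d)}$ in which the edges evolve independently, a closed edge (state $0$) becoming open (state $1$) at rate $p\mu$ and an open edge becoming closed at rate $(1-p)\mu$; its stationary distribution is the product measure $\pi_p$ with density $p$. Let $\mathcal{P}$ be the law of $\eta$ when $\eta_0$ has distribution $\pi_p$. Given $\eta$, let $X=(X_t)_{t\ge 0}$ be the walk with $X_0=x$ which at rate $1$ chooses a neighbour of its position in $\mathbb{Z}_n^d$ uniformly at random and moves there if and only if the connecting edge is open at that time; write $\mathbb{P}_{x,\eta}$ for its law. Let $\pi$ be the uniform distribution on $\mathbb{Z}_n^d$ and let $$t_{\rm mix}(\varepsilon,\eta)=\max_{x\in\mathbb{Z}_n^d}\,\min\bigl\{t\ge 0:\ \|\mathbb{P}_{x,\eta}(X_t=\cdot)-\pi\|_{\rm TV}\le\varepsilon\bigr\}\in[0,\infty]$$ be the quenched $\varepsilon$-mixing time. **Proposition 1.6.** Given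 $d\ge 1$, $\varepsilon\in(0,1)$, $p\in[0,1)$ and $M>0$, there exist $\beta>0$ and $n_0>0$ such that, for all $n\ge n_0$ and all $\mu\in(0,1/2]$, if $\eta=(\eta_t)_{t\ge0}$ is dynamical percolation on $\mathbb{Z}_n^d$ with parameters $p$ and $\mu$ started in stationarity, then $$\mathcal{P}\bigl(\eta:\ t_{\rm mix}(\varepsilon,\eta)\le\beta n^2\bigr)\le\frac1M\qquad\text{and}\qquad \mathcal{P}\Bigl(\eta:\ t_{\rm mix}(\varepsilon,\eta)\le\frac{\beta}{\mu}\Bigr)\le\frac1M .$$ -/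

import Mathlib

open MeasureTheory ProbabilityTheory
open scoped ENNReal NNReal

noncomputable section

namespace DynPerc

/-! ### The torus -/

/-- The vertex set of the discrete torus `ℤ_n^d`. -/
abbrev Vertex (d n : ℕ) : Type := Fin d → ZMod n

/-- The unit vector in coordinate direction `i`. -/
def unitVec {d n : ℕ} (i : Fin d) : Vertex d n := Pi.single i 1

/-- The edge set of the torus: `(x, i)` stands for the edge joining `x` and `x + e_i`.
For `n ≥ 3` every unordered pair of nearest neighbours is joined by exactly one such edge. -/
abbrev Edge (d n : ℕ) : Type := Vertex d n × Fin d

/-- A configuration declares every edge open (`true`, i.e. `1`) or closed (`false`, i.e. `0`). -/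
abbrev Config (d n : ℕ) : Type := Edge d n → Bool

/-- The `2 d` directions in which a walker may try to move: `(i, true)` is `+ e_i` and
`(i, false)` is `- e_i`. -/
abbrev Direction (d : ℕ) : Type := Fin d × Bool

/-- The neighbour of `x` in the given direction. -/
def neighbour {d n : ℕ} (x : Vertex d n) : Direction d → Vertex d n
  | (i, true) => x + unitVec i
  | (i, false) => x - unitVec i

/-- The edge joining `x` to its neighbour in the given direction. -/
def edgeTo {d n : ℕ} (x : Vertex d n) : Direction d → Edge d n
  | (i, true) => (x, i)
  | (i, false) => (x - unitVec i, i)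

/-! ### A sequence of independent exponential times -/

instance isProbabilityMeasure_exp_one : IsProbabilityMeasure (expMeasure 1) :=
  isProbabilityMeasure_expMeasure one_pos

/-- The law of a sequence of i.i.d. exponential random variables with rate `1`. -/
def expSeq : Measure (ℕ → ℝ) := Measure.infinitePi fun _ => expMeasure 1

instance : IsProbabilityMeasure expSeq := by unfold expSeq; infer_instance

/-! ### Dynamical percolation started in stationarity -/

/-- The Bernoulli law with success probability `p ∈ [0, 1]`. -/
def bernoulliLaw (p : ℝ) : Measure Bool :=
  p.toNNReal • Measure.dirac true + (1 - p).toNNReal • Measure.dirac false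

instance (p : ℝ) : IsFiniteMeasure (bernoulliLaw p) := by unfold bernoulliLaw; infer_instance

/-- The stationary law `π_p`: product measure with density `p` on configurations. -/
def stationaryLaw (d n : ℕ) [NeZero n] (p : ℝ) : Measure (Config d n) :=
  Measure.pi fun _ => bernoulliLaw p

/-- The rate at which an edge leaves its present state: a closed edge opens at rate `p μ`, an open
edge closes at rate `(1 - p) μ`. -/
def flipRate (p μ : ℝ) : Bool → ℝ
  | false => p * μ
  | true => (1 - p) * μ

/-- The time that an edge with initial state `b` spends in its state between its `k`-th and its
`(k + 1)`-st switch (the state is then `not^[k] b`): an exponential variable `T k` of rate `1`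
divided by the rate of leaving that state (so the time is infinite if that rate is `0`). -/
def holdingTime (p μ : ℝ) (b : Bool) (T : ℕ → ℝ) (k : ℕ) : ℝ≥0∞ :=
  ENNReal.ofReal (T k) / ENNReal.ofReal (flipRate p μ (not^[k] b))

/-- The time of the `(k + 1)`-st switch of an edge with initial state `b`. -/
def flipTime (p μ : ℝ) (b : Bool) (T : ℕ → ℝ) (k : ℕ) : ℝ≥0∞ :=
  ∑ j ∈ Finset.range (k + 1), holdingTime p μ b T j

/-- The state at time `t` of an edge with initial state `b`: it has been switched once for every
switching time in `[0, t]`. (Almost surely there are finitely many.) -/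
def edgeState (p μ : ℝ) (b : Bool) (T : ℕ → ℝ) (t : ℝ) : Bool :=
  not^[{k : ℕ | flipTime p μ b T k ≤ ENNReal.ofReal t}.ncard] b

/-- The sample space of the environment: an initial configuration, and for every edge a sequence of
exponential variables of rate `1`. -/
abbrev EnvSpace (d n : ℕ) : Type := Config d n × (Edge d n → ℕ → ℝ)

/-- The probability measure `𝒫` of dynamical percolation started in stationarity: the initial
configuration has law `π_p`, and the exponential variables are independent of it and of each
other. -/
def envMeasure (d n : ℕ) [NeZero n] (p : ℝ) : Measure (EnvSpace d n) :=
  (stationaryLaw d n p).prod (Measure.pi fun _ => expSeq)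

/-- The environment `η = (η_t)`: dynamical percolation with parameters `p` and `μ`, where the edges
evolve independently. -/
def env {d n : ℕ} (p μ : ℝ) (ω : EnvSpace d n) (t : ℝ) : Config d n :=
  fun e => edgeState p μ (ω.1 e) (ω.2 e) t

/-! ### Random walk in a given environment -/

/-- The sample space of the walker: the waiting times between the rings of its clock and the
directions chosen at these rings. -/
abbrev WalkSpace (d : ℕ) : Type := (ℕ → ℝ) × (ℕ → Direction d)

/-- The walker's clock rings at rate `1` and at each ring a direction is chosen uniformly at
random, everything being independent. -/
def walkMeasure (d : ℕ) [NeZero d] : Measure (WalkSpace d) :=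
  expSeq.prod (Measure.infinitePi fun _ => (PMF.uniformOfFintype (Direction d)).toMeasure)

/-- The time of the `(k + 1)`-st ring of the clock. -/
def ringTime (T : ℕ → ℝ) (k : ℕ) : ℝ := ∑ j ∈ Finset.range (k + 1), T j

/-- A walker at `x` moves in direction `a` if and only if the connecting edge is open. -/
def move {d n : ℕ} (c : Config d n) (x : Vertex d n) (a : Direction d) : Vertex d n :=
  if c (edgeTo x a) = true then neighbour x a else x

/-- The position after `k` rings of the walker who starts from `x` in the environment `η`. -/
def posAfter {d n : ℕ} (η : ℝ → Config d n) (x : Vertex d n) (w : WalkSpace d) : ℕ → Vertex d n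
  | 0 => x
  | k + 1 => move (η (ringTime w.1 k)) (posAfter η x w k) (w.2 k)

/-- The position `X_t` at time `t` of the walker who starts from `x` in the environment `η`.
(Almost surely there are finitely many rings in `[0, t]`.) -/
def walk {d n : ℕ} (η : ℝ → Config d n) (x : Vertex d n) (t : ℝ) (w : WalkSpace d) : Vertex d n :=
  posAfter η x w {k : ℕ | ringTime w.1 k ≤ t}.ncard

/-- The quenched probability `P_{x,η}(X_t = y)`. -/
def quenchedProb {d n : ℕ} [NeZero d] (η : ℝ → Config d n) (x : Vertex d n) (t : ℝ)
    (y : Vertex d n) : ℝ :=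
  (walkMeasure d).real {w | walk η x t w = y}

/-! ### Quenched mixing times -/

/-- The total variation distance between two laws on a finite set, given by their mass functions. -/
def tvDist {V : Type*} [Fintype V] (f g : V → ℝ) : ℝ := (∑ y, |f y - g y|) / 2

/-- The mass function of the uniform distribution `π`. -/
def uniformMass (V : Type*) [Fintype V] : V → ℝ := fun _ => (Fintype.card V : ℝ)⁻¹

/-- `t_mix(ε, x, η)`: the first time at which the quenched law of the walk from `x` is within `ε` of
uniform in total variation; it is `∞` if there is no such time. -/
def tmixFrom {d n : ℕ} [NeZero d] [NeZero n] (ε : ℝ) (x : Vertex d n) (η : ℝ → Config d n) : ℝ≥0∞ :=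
  ⨅ (t : ℝ≥0) (_ : tvDist (quenchedProb η x t) (uniformMass (Vertex d n)) ≤ ε), (t : ℝ≥0∞)

/-- The quenched mixing time `t_mix(ε, η) = max_x t_mix(ε, x, η)`. -/
def tmix {d n : ℕ} [NeZero d] [NeZero n] (ε : ℝ) (η : ℝ → Config d n) : ℝ≥0∞ :=
  ⨆ x : Vertex d n, tmixFrom ε x η

end DynPerc

end

noncomputable section

namespace DynPerc

/-! ### Symmetric averaging operators -/

section Average

variable {V D : Type*} [Fintype V] [Fintype D]

/-- The mean of `f` after one step in a uniformly chosen direction, if a step from `x` in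
direction `a` leads to `m x a`. -/
def avg (m : V → D → V) (f : V → ℝ) (x : V) : ℝ := (∑ a, f (m x a)) / Fintype.card D

/-- The averaging operator is symmetric with respect to the counting measure. -/
def IsSymm (m : V → D → V) : Prop :=
  ∀ f g : V → ℝ, ∑ x, g x * avg m f x = ∑ x, avg m g x * f x

omit [Fintype V] in
lemma avg_nonneg (m : V → D → V) {f : V → ℝ} (hf : ∀ x, 0 ≤ f x) (x : V) : 0 ≤ avg m f x :=
  div_nonneg (Finset.sum_nonneg fun _ _ => hf _) (Nat.cast_nonneg _)

omit [Fintype V] in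
lemma avg_const [Nonempty D] (m : V → D → V) (c : ℝ) (x : V) : avg m (fun _ => c) x = c := by
  have : (Fintype.card D : ℝ) ≠ 0 := by exact_mod_cast Fintype.card_ne_zero
  simp [avg, this]

omit [Fintype V] in
lemma avg_le_one [Nonempty D] (m : V → D → V) {f : V → ℝ} (hf : ∀ x, f x ≤ 1) (x : V) :
    avg m f x ≤ 1 := by
  have h : (0 : ℝ) < Fintype.card D := by exact_mod_cast Fintype.card_pos
  rw [avg, div_le_one h]
  calc ∑ a, f (m x a) ≤ ∑ _a : D, (1 : ℝ) := Finset.sum_le_sum fun _ _ => hf _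
    _ = Fintype.card D := by simp

lemma IsSymm.sum_avg [Nonempty D] {m : V → D → V} (hm : IsSymm m) (f : V → ℝ) :
    ∑ x, avg m f x = ∑ x, f x := by
  have := hm f (fun _ => 1)
  simpa [avg_const] using this

/-- The variance of `f` after one step from `x`. -/
def stepVar (m : V → D → V) (f : V → ℝ) (x : V) : ℝ :=
  (∑ a, (f (m x a) - avg m f x) ^ 2) / Fintype.card D

omit [Fintype V] in
lemma stepVar_eq [Nonempty D] (m : V → D → V) (f : V → ℝ) (x : V) :
    stepVar m f x = avg m (fun y => f y ^ 2) x - avg m f x ^ 2 := by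
  have h : (Fintype.card D : ℝ) ≠ 0 := by exact_mod_cast Fintype.card_ne_zero
  have h1 : ∑ a, f (m x a) = Fintype.card D * avg m f x := by rw [avg]; field_simp
  have h2 : ∑ a, (f (m x a) - avg m f x) ^ 2
      = ∑ a, f (m x a) ^ 2 - Fintype.card D * avg m f x ^ 2 := by
    simp only [sub_sq, Finset.sum_add_distrib, Finset.sum_sub_distrib, ← Finset.mul_sum,
      ← Finset.sum_mul, h1]
    simp
    ring
  rw [stepVar, h2, sub_div, avg]
  congr 1
  field_simp

lemma IsSymm.sum_stepVar [Nonempty D] {m : V → D → V} (hm : IsSymm m) (f : V → ℝ) :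
    ∑ x, stepVar m f x = ∑ x, f x ^ 2 - ∑ x, avg m f x ^ 2 := by
  simp only [stepVar_eq, Finset.sum_sub_distrib]
  rw [hm.sum_avg (fun y => f y ^ 2)]

lemma abs_mul_le_of_pos {a b s : ℝ} (hs : 0 < s) :
    |a * b| ≤ s / 2 * a ^ 2 + b ^ 2 / (2 * s) := by
  have h : s / 2 * a ^ 2 + b ^ 2 / (2 * s) - |a * b| = (s * |a| - |b|) ^ 2 / (2 * s) := by
    rw [abs_mul, ← sq_abs a, ← sq_abs b]
    field_simp
    ring
  have : 0 ≤ (s * |a| - |b|) ^ 2 / (2 * s) := by positivity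
  linarith

omit [Fintype V] in
/-- The covariance of two functions after one step, one of them `1`-Lipschitz. -/
lemma abs_cov_le [Nonempty D] (m : V → D → V) (v φ : V → ℝ) (x : V)
    (hφ : ∀ a, |φ (m x a) - φ x| ≤ 1) {s : ℝ} (hs : 0 < s) :
    |avg m v x * avg m φ x - avg m (fun y => v y * φ y) x| ≤ s / 2 + stepVar m v x / (2 * s) := by
  have hc : (0 : ℝ) < Fintype.card D := by exact_mod_cast Fintype.card_pos
  have h1 : ∑ a, v (m x a) = Fintype.card D * avg m v x := by rw [avg]; field_simp
  have h2 : ∑ a, φ (m x a) = Fintype.card D * avg m φ x := by rw [avg]; field_simp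
  have key : avg m v x * avg m φ x - avg m (fun y => v y * φ y) x
      = (∑ a, -((φ (m x a) - φ x) * (v (m x a) - avg m v x))) / Fintype.card D := by
    have : ∑ a, -((φ (m x a) - φ x) * (v (m x a) - avg m v x))
        = Fintype.card D * (avg m v x * avg m φ x) - ∑ a, v (m x a) * φ (m x a) := by
      have : ∀ a, -((φ (m x a) - φ x) * (v (m x a) - avg m v x))
          = φ (m x a) * avg m v x - v (m x a) * φ (m x a) + φ x * v (m x a)
            - φ x * avg m v x := fun a => by ring
      simp only [this, Finset.sum_sub_distrib, Finset.sum_add_distrib, ← Finset.mul_sum,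
        ← Finset.sum_mul, h1, h2]
      simp
      ring
    rw [this, sub_div, mul_div_cancel_left₀ _ hc.ne']
    rfl
  rw [key, abs_div, abs_of_pos hc, div_le_iff₀ hc]
  calc |∑ a, -((φ (m x a) - φ x) * (v (m x a) - avg m v x))|
      ≤ ∑ a, |-((φ (m x a) - φ x) * (v (m x a) - avg m v x))| := Finset.abs_sum_le_sum_abs _ _
    _ ≤ ∑ a, (s / 2 + (v (m x a) - avg m v x) ^ 2 / (2 * s)) := by
        refine Finset.sum_le_sum fun a _ => ?_
        rw [abs_neg]
        refine (abs_mul_le_of_pos hs).trans ?_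
        have : (φ (m x a) - φ x) ^ 2 ≤ 1 := by
          rw [← sq_abs]; exact pow_le_one₀ (abs_nonneg _) (hφ a)
        nlinarith
    _ = (s / 2 + stepVar m v x / (2 * s)) * Fintype.card D := by
        rw [Finset.sum_add_distrib, ← Finset.sum_div Finset.univ _ (2 * s), stepVar]
        simp only [Finset.sum_const, Finset.card_univ, nsmul_eq_mul]
        field_simp

omit [Fintype V] in
lemma sq_sub_avg_le_of_lazy [Nonempty D] (m : V → D → V) (v : V → ℝ) (x : V) (a : D)
    (ha : m x a = x) : (v x - avg m v x) ^ 2 ≤ Fintype.card D * stepVar m v x := by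
  have hc : (Fintype.card D : ℝ) ≠ 0 := by exact_mod_cast Fintype.card_ne_zero
  rw [stepVar, mul_div_cancel₀ _ hc]
  have := Finset.single_le_sum (f := fun a => (v (m x a) - avg m v x) ^ 2)
    (fun _ _ => sq_nonneg _) (Finset.mem_univ a)
  simpa [ha] using this

/-- One step changes the mean of a `1`-Lipschitz function, which is harmonic at all points
without holding outside an exceptional set `Z`, by little more than the dissipation of energy. -/
lemma IsSymm.drift_le [Nonempty D] {m : V → D → V} (hm : IsSymm m) {v φ : V → ℝ}
    (hv0 : ∀ x, 0 ≤ v x) (hv1 : ∀ x, v x ≤ 1) (hφ : ∀ x a, |φ (m x a) - φ x| ≤ 1) (Z : Finset V)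
    (hZ : ∀ x ∉ Z, (∃ a, m x a = x) ∨ avg m φ x = φ x) {s : ℝ} (hs : 0 < s) :
    ∑ x, avg m v x * φ x - ∑ x, v x * φ x ≤ s / 2 * Fintype.card V
      + Fintype.card D / (2 * s) * (∑ x, v x ^ 2 - ∑ x, avg m v x ^ 2) + Z.card := by
  classical
  have hc : (1 : ℝ) ≤ Fintype.card D := by exact_mod_cast Fintype.card_pos
  have e1 : ∑ x, avg m v x * φ x = ∑ x, v x * avg m φ x := (hm φ v).symm
  have e2 : ∑ x, avg m (fun y => v y * φ y) x = ∑ x, v x * φ x := hm.sum_avg _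
  have key : ∑ x, avg m v x * φ x - ∑ x, v x * φ x
      = ∑ x, (1 / 2 * (avg m v x * avg m φ x - avg m (fun y => v y * φ y) x)
        - 1 / 2 * ((φ x - avg m φ x) * (v x - avg m v x))) := by
    have : ∀ x, (1 / 2 * (avg m v x * avg m φ x - avg m (fun y => v y * φ y) x)
        - 1 / 2 * ((φ x - avg m φ x) * (v x - avg m v x)))
        = 1 / 2 * (avg m v x * φ x) + 1 / 2 * (v x * avg m φ x) - 1 / 2 * (v x * φ x)
          - 1 / 2 * avg m (fun y => v y * φ y) x := fun x => by ring
    simp only [this, Finset.sum_sub_distrib, Finset.sum_add_distrib, ← Finset.mul_sum]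
    rw [e2, ← e1]
    ring
  have hvar : ∀ x, 0 ≤ stepVar m v x := fun x =>
    div_nonneg (Finset.sum_nonneg fun _ _ => sq_nonneg _) (Nat.cast_nonneg _)
  have hq : ∀ x, |φ x - avg m φ x| ≤ 1 := fun x => by
    have : φ x - avg m φ x = (∑ a, (φ x - φ (m x a))) / Fintype.card D := by
      rw [Finset.sum_sub_distrib, sub_div, avg]
      simp
    rw [this, abs_div, Nat.abs_cast, div_le_one (by linarith)]
    refine (Finset.abs_sum_le_sum_abs _ _).trans ?_
    calc ∑ a, |φ x - φ (m x a)| ≤ ∑ _a : D, (1 : ℝ) :=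
          Finset.sum_le_sum fun a _ => by rw [abs_sub_comm]; exact hφ x a
      _ = Fintype.card D := by simp
  have hpt : ∀ x, 1 / 2 * (avg m v x * avg m φ x - avg m (fun y => v y * φ y) x)
        - 1 / 2 * ((φ x - avg m φ x) * (v x - avg m v x))
      ≤ s / 2 + Fintype.card D / (2 * s) * stepVar m v x + if x ∈ Z then 1 else 0 := by
    intro x
    have h1 := abs_le.1 (abs_cov_le m v φ x (hφ x) hs)
    have h2 : stepVar m v x / (2 * s) ≤ Fintype.card D / (2 * s) * stepVar m v x := by
      rw [div_mul_eq_mul_div]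
      gcongr
      nlinarith [hvar x]
    have h3 : |(φ x - avg m φ x) * (v x - avg m v x)|
        ≤ s / 2 + Fintype.card D / (2 * s) * stepVar m v x + if x ∈ Z then 1 else 0 := by
      have h0 : 0 ≤ Fintype.card D / (2 * s) * stepVar m v x :=
        mul_nonneg (by positivity) (hvar x)
      by_cases hx : x ∈ Z
      · rw [if_pos hx, abs_mul]
        have : |v x - avg m v x| ≤ 1 := abs_le.2
          ⟨by linarith [hv0 x, avg_le_one m hv1 x], by linarith [hv1 x, avg_nonneg m hv0 x]⟩
        have := mul_le_one₀ (hq x) (abs_nonneg _) this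
        linarith
      · rw [if_neg hx, add_zero]
        rcases hZ x hx with ⟨a, ha⟩ | h
        · refine (abs_mul_le_of_pos hs).trans ?_
          have h4 : (φ x - avg m φ x) ^ 2 ≤ 1 := by
            rw [← sq_abs]; exact pow_le_one₀ (abs_nonneg _) (hq x)
          have h5 := sq_sub_avg_le_of_lazy m v x a ha
          have h6 : (v x - avg m v x) ^ 2 / (2 * s)
              ≤ Fintype.card D / (2 * s) * stepVar m v x := by
            rw [div_mul_eq_mul_div]; gcongr
          nlinarith
        · rw [h, sub_self, zero_mul, abs_zero]; linarith
    have h3' := abs_le.1 h3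
    have : (0 : ℝ) ≤ if x ∈ Z then 1 else 0 := by split_ifs <;> norm_num
    linarith [h1.2, h3'.1]
  rw [key]
  refine (Finset.sum_le_sum fun x _ => hpt x).trans (le_of_eq ?_)
  rw [Finset.sum_add_distrib, Finset.sum_add_distrib, ← Finset.mul_sum, hm.sum_stepVar]
  simp
  ring

end Average

/-! ### Killed evolution -/

section Killed

variable {V D : Type*} [Fintype V] [Fintype D] [DecidableEq V]

/-- The evolution of the indicator of `A` under the steps `m 0, m 1, …`, killed outside `U`. -/
def killed (m : ℕ → V → D → V) (A U : Finset V) : ℕ → V → ℝ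
  | 0 => fun x => if x ∈ A then 1 else 0
  | k + 1 => fun x => if x ∈ U then avg (m k) (killed m A U k) x else 0

omit [Fintype V] in
lemma killed_nonneg (m : ℕ → V → D → V) (A U : Finset V) (k : ℕ) (x : V) :
    0 ≤ killed m A U k x := by
  induction k generalizing x with
  | zero => simp only [killed]; split_ifs <;> norm_num
  | succ k ih => simp only [killed]; split_ifs; exacts [avg_nonneg _ ih _, le_rfl]

omit [Fintype V] in
lemma killed_le_one [Nonempty D] (m : ℕ → V → D → V) (A U : Finset V) (k : ℕ) (x : V) :
    killed m A U k x ≤ 1 := by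
  induction k generalizing x with
  | zero => simp only [killed]; split_ifs <;> norm_num
  | succ k ih => simp only [killed]; split_ifs; exacts [avg_le_one _ ih _, zero_le_one]

/-- The mass lost by the killed evolution within `k` steps. -/
lemma killed_loss_le [Nonempty D] {m : ℕ → V → D → V} (hm : ∀ k, IsSymm (m k)) {φ : V → ℝ}
    (hφ0 : ∀ x, 0 ≤ φ x) (hφ : ∀ k x a, |φ (m k x a) - φ x| ≤ 1) (Z : Finset V)
    (hZ : ∀ k, ∀ x ∉ Z, (∃ a, m k x a = x) ∨ avg (m k) φ x = φ x)
    (A U : Finset V) {a r s : ℝ} (hA : ∀ x ∈ A, φ x ≤ a) (hU : ∀ x ∉ U, r ≤ φ x)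
    (hs : 0 < s) (k : ℕ) :
    r * (A.card - ∑ x, killed m A U k x) ≤ a * A.card + Fintype.card D / (2 * s) * A.card
      + k * (s / 2 * Fintype.card V + Z.card) := by
  have hstep : ∀ k, ∑ x, killed m A U k x * φ x - r * ∑ x, killed m A U k x
      + Fintype.card D / (2 * s) * ∑ x, killed m A U k x ^ 2
      ≤ a * A.card - r * A.card + Fintype.card D / (2 * s) * A.card
        + k * (s / 2 * Fintype.card V + Z.card) := by
    intro k
    induction k with
    | zero =>
      simp only [killed, ite_mul, one_mul, zero_mul, ite_pow, one_pow, ne_eq, OfNat.ofNat_ne_zero,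
        not_false_eq_true, zero_pow, Finset.sum_ite_mem, Finset.univ_inter, Finset.sum_const,
        nsmul_eq_mul, mul_one, Nat.cast_zero, add_zero]
      have : ∑ x ∈ A, φ x ≤ a * A.card := by
        refine (Finset.sum_le_sum hA).trans (le_of_eq ?_)
        simp [mul_comm]
      linarith
    | succ k ih =>
      set v := killed m A U k with hv
      have h1 := (hm k).drift_le (v := v) (killed_nonneg m A U k) (killed_le_one m A U k) (hφ k) Z
        (hZ k) hs
      have hav := avg_nonneg (m k) (f := v) (killed_nonneg m A U k)
      have h2 : ∑ x, killed m A U (k + 1) x ^ 2 ≤ ∑ x, avg (m k) v x ^ 2 := by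
        refine Finset.sum_le_sum fun x _ => ?_
        simp only [killed]
        split_ifs
        · exact le_rfl
        · simpa using sq_nonneg _
      have h3 : ∑ x, killed m A U (k + 1) x * φ x - r * ∑ x, killed m A U (k + 1) x
          ≤ ∑ x, avg (m k) v x * φ x - r * ∑ x, v x := by
        rw [← (hm k).sum_avg v, Finset.mul_sum, Finset.mul_sum, ← Finset.sum_sub_distrib,
          ← Finset.sum_sub_distrib]
        refine Finset.sum_le_sum fun x _ => ?_
        simp only [killed]
        split_ifs with hx
        · exact le_rfl
        · nlinarith [hU x hx, hav x]
      have h4 := mul_le_mul_of_nonneg_left h2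
        (show (0 : ℝ) ≤ Fintype.card D / (2 * s) by positivity)
      push_cast
      linarith
  have h := hstep k
  have h1 : 0 ≤ ∑ x, killed m A U k x * φ x :=
    Finset.sum_nonneg fun x _ => mul_nonneg (killed_nonneg _ _ _ _ _) (hφ0 x)
  have h2 : 0 ≤ Fintype.card D / (2 * s) * ∑ x, killed m A U k x ^ 2 := by positivity
  linarith

end Killed

/-! ### Walks driven by independent uniform directions -/

section Paths

variable {V D : Type*}

/-- The position after `k` steps of the walk that starts from `x` and uses the directions `a`. -/
def pathPos (m : ℕ → V → D → V) (x : V) (a : ℕ → D) : ℕ → V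
  | 0 => x
  | k + 1 => m k (pathPos m x a k) (a k)

lemma pathPos_congr (m : ℕ → V → D → V) (x : V) {a a' : ℕ → D} (k : ℕ)
    (h : ∀ j < k, a j = a' j) : pathPos m x a k = pathPos m x a' k := by
  induction k with
  | zero => rfl
  | succ k ih =>
    simp only [pathPos]
    rw [ih fun j hj => h j (hj.trans k.lt_succ_self), h k k.lt_succ_self]

/-- The walk has stayed in `U` during its first `k` steps. -/
def Stays (m : ℕ → V → D → V) (U : Finset V) (x : V) (a : ℕ → D) (k : ℕ) : Prop :=
  ∀ j < k, pathPos m x a (j + 1) ∈ U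

lemma stays_congr (m : ℕ → V → D → V) (U : Finset V) (x : V) {a a' : ℕ → D} (k : ℕ)
    (h : ∀ j < k, a j = a' j) : Stays m U x a k ↔ Stays m U x a' k := by
  refine forall₂_congr fun j hj => ?_
  rw [pathPos_congr m x (j + 1) fun i hi => h i (by omega)]

lemma stays_succ (m : ℕ → V → D → V) (U : Finset V) (x : V) (a : ℕ → D) (k : ℕ) :
    Stays m U x a (k + 1) ↔ Stays m U x a k ∧ m k (pathPos m x a k) (a k) ∈ U := by
  simp only [Stays, Nat.lt_succ_iff_lt_or_eq]
  constructor
  · exact fun h => ⟨fun j hj => h j (.inl hj), h k (.inr rfl)⟩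
  · rintro ⟨h, h'⟩ j (hj | rfl)
    exacts [h j hj, h']

variable [Fintype D] [Nonempty D] [MeasurableSpace D] [MeasurableSingletonClass D]

/-- The law of a sequence of independent uniformly distributed directions. -/
abbrev dirSeq (D : Type*) [Fintype D] [Nonempty D] [MeasurableSpace D] : Measure (ℕ → D) :=
  Measure.infinitePi fun _ => (PMF.uniformOfFintype D).toMeasure

lemma measurable_of_eq_on_prefix {β : Type*} [MeasurableSpace β] {k : ℕ} {G : (ℕ → D) → β}
    (hG : ∀ a a' : ℕ → D, (∀ j < k, a j = a' j) → G a = G a') :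
    ∃ G' : (Finset.range k → D) → β, Measurable G' ∧ G = fun a => G' fun i => a i := by
  classical
  obtain ⟨b⟩ := ‹Nonempty D›
  have : DiscreteMeasurableSpace (Finset.range k → D) := inferInstance
  refine ⟨fun r => G fun j => if h : j ∈ Finset.range k then r ⟨j, h⟩ else b,
    .of_discrete, ?_⟩
  funext a
  exact hG _ _ fun j hj => by simp [hj]

/-- A direction is uniformly distributed given the earlier ones. -/
lemma integral_dirSeq_step {k : ℕ} {G : (ℕ → D) → D → ℝ} {C : ℝ} (hC : ∀ a b, |G a b| ≤ C)
    (hG : ∀ (a a' : ℕ → D), (∀ j < k, a j = a' j) → G a = G a') :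
    ∫ a, G a (a k) ∂(dirSeq D) = ∫ a, (∑ b, G a b) / Fintype.card D ∂(dirSeq D) := by
  classical
  have hmeas : ∀ b, Measurable fun a => G a b := fun b => by
    obtain ⟨G', hG', h⟩ := measurable_of_eq_on_prefix (G := fun a => G a b) (k := k)
      fun a a' h => by rw [hG a a' h]
    rw [h]
    exact hG'.comp (by fun_prop)
  have hint : ∀ b, Integrable (fun a => G a b) (dirSeq D) := fun b =>
    Integrable.of_bound (hmeas b).aestronglyMeasurable C (.of_forall fun a => hC a b)
  have hI : ∀ b : D, Measurable fun x : D => if x = b then (1 : ℝ) else 0 := fun b => .of_discrete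
  have hone : ∀ b, ∫ a, (if a k = b then (1 : ℝ) else 0) * G a b ∂(dirSeq D)
      = (∫ a, G a b ∂(dirSeq D)) / Fintype.card D := by
    intro b
    obtain ⟨G', hG', h⟩ := measurable_of_eq_on_prefix (G := fun a => G a b) (k := k)
      fun a a' h => by rw [hG a a' h]
    have hind : iIndepFun (fun (i : ℕ) (a : ℕ → D) => a i) (dirSeq D) :=
      iIndepFun_infinitePi (X := fun _ => id) fun _ => measurable_id
    have hi := hind.indepFun_finset {k} (Finset.range k) (by simp) fun i => measurable_pi_apply i
    have hi2 : IndepFun (fun a : ℕ → D => if a k = b then (1 : ℝ) else 0) (fun a => G a b)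
        (dirSeq D) := by
      rw [h]
      exact hi.comp (φ := fun r => if r ⟨k, by simp⟩ = b then (1 : ℝ) else 0) (ψ := G')
        Measurable.of_discrete hG'
    have h1 := hi2.integral_fun_mul_eq_mul_integral
      ((hI b).comp (measurable_pi_apply k)).aestronglyMeasurable (hmeas b).aestronglyMeasurable
    rw [h1]
    have h2 : ∫ a, (if a k = b then (1 : ℝ) else 0) ∂(dirSeq D) = (Fintype.card D : ℝ)⁻¹ := by
      have := integral_map (μ := dirSeq D) (φ := fun a : ℕ → D => a k)
        (f := fun x : D => if x = b then (1 : ℝ) else 0)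
        (measurable_pi_apply k).aemeasurable (hI b).aestronglyMeasurable
      rw [← this, Measure.infinitePi_map_eval, PMF.integral_eq_sum]
      simp
    rw [h2, div_eq_inv_mul]
  have hsum : ∀ a : ℕ → D, G a (a k) = ∑ b, (if a k = b then (1 : ℝ) else 0) * G a b := by
    intro a; simp
  simp_rw [hsum]
  rw [integral_finsetSum]
  · simp_rw [hone, Finset.sum_div]
    rw [integral_finsetSum]
    · simp_rw [integral_div]
    · exact fun b _ => (hint b).div_const _
  · intro b _
    refine (hint b).bdd_mul (c := 1) ((hI b).comp (measurable_pi_apply k)).aestronglyMeasurable ?_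
    refine .of_forall fun a => ?_
    simp only [Real.norm_eq_abs]
    split_ifs <;> simp

variable [Fintype V] [DecidableEq V]

open Classical in
/-- The killed evolution is the law of the killed walk. -/
lemma sum_integral_stays {m : ℕ → V → D → V} (hm : ∀ k, IsSymm (m k)) (A U : Finset V) (k : ℕ)
    (f : V → ℝ) :
    ∑ x ∈ A, ∫ a, (if Stays m U x a k then f (pathPos m x a k) else 0) ∂(dirSeq D)
      = ∑ y, killed m A U k y * f y := by
  induction k generalizing f with
  | zero => simp [Stays, pathPos, killed]
  | succ k ih =>
    set g : V → ℝ := fun y => if y ∈ U then f y else 0 with hg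
    have h1 : ∀ x, ∫ a, (if Stays m U x a (k + 1) then f (pathPos m x a (k + 1)) else 0)
        ∂(dirSeq D)
        = ∫ a, (if Stays m U x a k then avg (m k) g (pathPos m x a k) else 0) ∂(dirSeq D) := by
      intro x
      obtain ⟨C, hC⟩ : ∃ C, ∀ y, |g y| ≤ C :=
        ⟨∑ y, |g y|, fun y => Finset.single_le_sum (f := fun y => |g y|)
          (fun _ _ => abs_nonneg _) (Finset.mem_univ y)⟩
      have := integral_dirSeq_step (k := k) (C := C)
        (G := fun (a : ℕ → D) b => if Stays m U x a k then g (m k (pathPos m x a k) b) else 0)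
        (fun a b => by
          split_ifs
          · exact hC _
          · simpa using (abs_nonneg _).trans (hC x))
        (fun a a' h => by
          funext b
          simp only [stays_congr m U x k h, pathPos_congr m x k h])
      refine Eq.trans (integral_congr_ae (.of_forall fun a => ?_))
        (this.trans (integral_congr_ae (.of_forall fun a => ?_)))
      · simp only [stays_succ, pathPos, hg]
        split_ifs <;> simp_all
      · simp only [avg]
        split_ifs <;> simp
    simp_rw [h1]
    rw [ih]
    rw [hm k]
    refine Finset.sum_congr rfl fun y _ => ?_
    simp only [killed, hg]
    split_ifs <;> simp

/-- The total probability of staying in `U` for `k` steps from a starting point in `A`. -/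
lemma sum_real_stays {m : ℕ → V → D → V} (hm : ∀ k, IsSymm (m k)) (A U : Finset V) (k : ℕ) :
    ∑ x ∈ A, (dirSeq D).real {a | Stays m U x a k} = ∑ y, killed m A U k y := by
  classical
  have h := sum_integral_stays hm A U k (fun _ => 1)
  simp only [mul_one] at h
  rw [← h]
  refine Finset.sum_congr rfl fun x _ => ?_
  have hms : MeasurableSet {a : ℕ → D | Stays m U x a k} := by
    obtain ⟨G', hG', h⟩ := measurable_of_eq_on_prefix (G := fun a : ℕ → D => Stays m U x a k)
      (k := k) fun a a' h => propext (stays_congr m U x k h)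
    rw [h]
    exact measurableSet_setOfPred.2 (hG'.comp (by fun_prop))
  rw [← integral_indicator_one hms]
  refine integral_congr_ae (.of_forall fun a => ?_)
  simp [Set.indicator_apply]

end Paths

/-! ### Moves on the torus -/

section Torus

variable {d n : ℕ}

/-- The opposite direction. -/
def opp (a : Direction d) : Direction d := (a.1, !a.2)

@[simp] lemma opp_opp (a : Direction d) : opp (opp a) = a := by simp [opp]

lemma neighbour_opp (x : Vertex d n) (a : Direction d) : neighbour (neighbour x a) (opp a) = x := by
  rcases a with ⟨i, _ | _⟩ <;> simp [neighbour, opp]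

lemma edgeTo_opp (x : Vertex d n) (a : Direction d) :
    edgeTo (neighbour x a) (opp a) = edgeTo x a := by
  rcases a with ⟨i, _ | _⟩ <;> simp [neighbour, opp, edgeTo]

/-- A move together with the reversal of the direction in case the move succeeds. -/
def moveRev (c : Config d n) (q : Vertex d n × Direction d) : Vertex d n × Direction d :=
  if c (edgeTo q.1 q.2) = true then (neighbour q.1 q.2, opp q.2) else q

lemma moveRev_involutive (c : Config d n) : Function.Involutive (moveRev c) := by
  rintro ⟨x, a⟩
  by_cases h : c (edgeTo x a) = true
  · have : moveRev c (x, a) = (neighbour x a, opp a) := if_pos h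
    rw [this, moveRev, if_pos (by rw [edgeTo_opp]; exact h)]
    simp [neighbour_opp]
  · have : moveRev c (x, a) = (x, a) := if_neg h
    rw [this, this]

lemma moveRev_fst (c : Config d n) (q : Vertex d n × Direction d) :
    (moveRev c q).1 = move c q.1 q.2 := by
  simp only [moveRev, move]
  split_ifs <;> rfl

lemma isSymm_move [NeZero n] (c : Config d n) : IsSymm (move c) := by
  intro f g
  have h := Equiv.sum_comp (moveRev_involutive c).toPerm
    (fun q : Vertex d n × Direction d => g q.1 * f (move c q.1 q.2))
  have h2 : ∀ q : Vertex d n × Direction d,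
      move c (moveRev c q).1 (moveRev c q).2 = q.1 := fun q => by
    rw [← moveRev_fst, moveRev_involutive c q]
  simp only [Function.Involutive.coe_toPerm, h2] at h
  simp only [moveRev_fst] at h
  rw [Fintype.sum_prod_type, Fintype.sum_prod_type] at h
  simp only [avg, mul_div_assoc', div_mul_eq_mul_div, ← Finset.sum_div, Finset.mul_sum,
    Finset.sum_mul]
  rw [h]

end Torus

/-! ### The height function -/

section Height

variable {n : ℕ}

lemma val_add_one_cases (hn : 2 ≤ n) (z : ZMod n) :
    (z.val + 1 < n ∧ (z + 1).val = z.val + 1) ∨ (z.val + 1 = n ∧ (z + 1).val = 0) := by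
  have : NeZero n := ⟨by omega⟩
  have : Fact (1 < n) := ⟨hn⟩
  have h := ZMod.val_lt z
  rw [ZMod.val_add, ZMod.val_one]
  rcases Nat.lt_or_ge (z.val + 1) n with h1 | h1
  · exact .inl ⟨h1, Nat.mod_eq_of_lt h1⟩
  · have : z.val + 1 = n := by omega
    exact .inr ⟨this, by rw [this, Nat.mod_self]⟩

/-- The distance of a residue from `n / 2`. -/
def height (z : ZMod n) : ℝ := |(z.val : ℝ) - (n / 2 : ℕ)|

lemma abs_height_add_one_sub (hn : 2 ≤ n) (z : ZMod n) : |height (z + 1) - height z| ≤ 1 := by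
  rcases val_add_one_cases hn z with ⟨_, h⟩ | ⟨h1, h⟩
  · rw [height, height, h]
    refine (abs_abs_sub_abs_le_abs_sub _ _).trans ?_
    push_cast
    rw [show (z.val : ℝ) + 1 - (n / 2 : ℕ) - (z.val - (n / 2 : ℕ)) = 1 by ring, abs_one]
  · rw [height, height, h]
    have h2 : (z.val : ℝ) + 1 = n := by exact_mod_cast h1
    have h3 : (2 * (n / 2 : ℕ) : ℝ) ≤ n := by exact_mod_cast Nat.mul_div_le n 2
    have h4 : (n : ℝ) ≤ 2 * (n / 2 : ℕ) + 1 := by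
      have : n ≤ 2 * (n / 2) + 1 := by omega
      exact_mod_cast this
    have h5 : (1 : ℝ) ≤ (n / 2 : ℕ) := by
      have : 1 ≤ n / 2 := by omega
      exact_mod_cast this
    rw [Nat.cast_zero, zero_sub, abs_neg, abs_of_nonneg (a := ((n / 2 : ℕ) : ℝ)) (by linarith),
      abs_of_nonneg (a := (z.val : ℝ) - _) (by linarith), abs_le]
    constructor <;> linarith

lemma abs_height_sub_one_sub (hn : 2 ≤ n) (z : ZMod n) : |height (z - 1) - height z| ≤ 1 := by
  have := abs_height_add_one_sub hn (z - 1)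
  rwa [sub_add_cancel, abs_sub_comm] at this

lemma height_add_height (hn : 2 ≤ n) (z : ZMod n) (h0 : z.val ≠ 0) (h1 : z.val ≠ n / 2)
    (h2 : z.val ≠ n - 1) : height (z + 1) + height (z - 1) = 2 * height z := by
  have hp := val_add_one_cases hn z
  have hm := val_add_one_cases hn (z - 1)
  rw [sub_add_cancel] at hm
  have hp' : (z + 1).val = z.val + 1 := by omega
  have hm' : z.val = (z - 1).val + 1 := by omega
  have hp'' : ((z + 1).val : ℝ) = z.val + 1 := by exact_mod_cast hp'
  have hm'' : ((z - 1).val : ℝ) = z.val - 1 := by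
    rw [eq_sub_iff_add_eq]; exact_mod_cast hm'.symm
  simp only [height, hp'', hm'']
  rcases Nat.lt_or_gt_of_ne h1 with h | h
  · have : (z.val : ℝ) + 1 ≤ (n / 2 : ℕ) := by exact_mod_cast h
    rw [abs_of_nonpos (by linarith), abs_of_nonpos (by linarith), abs_of_nonpos (by linarith)]
    ring
  · have : ((n / 2 : ℕ) : ℝ) + 1 ≤ z.val := by exact_mod_cast h
    rw [abs_of_nonneg (by linarith), abs_of_nonneg (by linarith), abs_of_nonneg (by linarith)]
    ring

lemma card_height_lt_le [NeZero n] {r : ℝ} (hr : 0 ≤ r) :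
    ((Finset.univ.filter fun z : ZMod n => height z < r).card : ℝ) ≤ 2 * r + 1 := by
  have h : (Finset.univ.filter fun z : ZMod n => height z < r).card
      ≤ (Finset.Icc (-⌊r⌋) ⌊r⌋).card := by
    refine Finset.card_le_card_of_injOn (fun z => (z.val : ℤ) - (n / 2 : ℕ)) ?_ ?_
    · intro z hz
      have hz : height z < r := by simpa using hz
      obtain ⟨h1, h2⟩ := abs_lt.1 hz
      simp only [Finset.coe_Icc, Set.mem_Icc]
      rw [neg_le, Int.le_floor, Int.le_floor]
      simp only [Int.cast_neg, Int.cast_sub, Int.cast_natCast]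
      constructor <;> linarith
    · intro z _ w _ h
      simp only [sub_left_inj, Nat.cast_inj] at h
      exact ZMod.val_injective n h
  have h0 : 0 ≤ ⌊r⌋ := Int.floor_nonneg.2 hr
  have h2 : ((Finset.Icc (-⌊r⌋) ⌊r⌋).card : ℤ) = 2 * ⌊r⌋ + 1 := by
    rw [Int.card_Icc, Int.toNat_of_nonneg (by linarith)]
    ring
  have h3 : ((Finset.Icc (-⌊r⌋) ⌊r⌋).card : ℝ) = 2 * ⌊r⌋ + 1 := by exact_mod_cast h2
  calc _ ≤ ((Finset.Icc (-⌊r⌋) ⌊r⌋).card : ℝ) := by exact_mod_cast h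
    _ ≤ 2 * r + 1 := by rw [h3]; linarith [Int.floor_le r]

lemma le_card_height_le [NeZero n] {a : ℝ} (ha : 0 ≤ a) (han : a < n / 2) :
    a ≤ ((Finset.univ.filter fun z : ZMod n => height z ≤ a).card : ℝ) := by
  have hlt : ∀ j < ⌊a⌋₊ + 1, n / 2 + j < n := by
    intro j hj
    have h1 : (j : ℝ) ≤ a := (Nat.le_floor_iff ha).1 (Nat.lt_succ_iff.1 hj)
    have h2 : (2 * (n / 2 : ℕ) : ℝ) ≤ n := by exact_mod_cast Nat.mul_div_le n 2
    have : ((n / 2 : ℕ) : ℝ) + j < n := by linarith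
    exact_mod_cast this
  have hval : ∀ j < ⌊a⌋₊ + 1, ((n / 2 + j : ℕ) : ZMod n).val = n / 2 + j :=
    fun j hj => ZMod.val_cast_of_lt (hlt j hj)
  have h : (Finset.range (⌊a⌋₊ + 1)).card
      ≤ (Finset.univ.filter fun z : ZMod n => height z ≤ a).card := by
    refine Finset.card_le_card_of_injOn (fun j => ((n / 2 + j : ℕ) : ZMod n)) ?_ ?_
    · intro j hj
      have hj : j < ⌊a⌋₊ + 1 := by simpa using hj
      have h1 : (j : ℝ) ≤ a := (Nat.le_floor_iff ha).1 (Nat.lt_succ_iff.1 hj)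
      refine Finset.mem_coe.2 (Finset.mem_filter.2 ⟨Finset.mem_univ _, ?_⟩)
      rw [height, hval j hj, Nat.cast_add]
      rw [add_sub_cancel_left, abs_of_nonneg (by positivity)]
      exact h1
    · intro i hi j hj h
      have hi : i < ⌊a⌋₊ + 1 := by simpa using hi
      have hj : j < ⌊a⌋₊ + 1 := by simpa using hj
      have := congrArg ZMod.val h
      simp only [hval i hi, hval j hj] at this
      omega
  rw [Finset.card_range] at h
  calc a ≤ ⌊a⌋₊ + 1 := (Nat.lt_floor_add_one a).le
    _ ≤ _ := by exact_mod_cast h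

end Height

section Slabs

variable {d n : ℕ} [NeZero d] [NeZero n]

lemma card_filter_coord_zero (p : ZMod n → Prop) [DecidablePred p] :
    (Finset.univ.filter fun x : Vertex d n => p (x 0)).card
      = (Finset.univ.filter p).card * n ^ (d - 1) := by
  have h : (Finset.univ.filter fun x : Vertex d n => p (x 0))
      = Fintype.piFinset fun i : Fin d => if i = 0 then Finset.univ.filter p else Finset.univ := by
    ext x
    simp only [Finset.mem_filter, Finset.mem_univ, true_and, Fintype.mem_piFinset]
    constructor
    · intro hx i
      split_ifs with hi
      · simpa [hi] using hx
      · simp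
    · intro hx
      simpa using hx 0
  rw [h, Fintype.card_piFinset, ← Finset.mul_prod_erase _ _ (Finset.mem_univ (0 : Fin d)),
    if_pos rfl]
  congr 1
  rw [Finset.prod_congr rfl (g := fun _ => n), Finset.prod_const, Finset.card_erase_of_mem
    (Finset.mem_univ _), Finset.card_univ, Fintype.card_fin]
  intro i hi
  rw [if_neg (Finset.ne_of_mem_erase hi), Finset.card_univ, ZMod.card]

/-- The points at which the height function may fail to be harmonic. -/
def kinks (d n : ℕ) [NeZero d] [NeZero n] : Finset (Vertex d n) :=
  Finset.univ.filter fun x => (x 0).val ∈ ({0, n / 2, n - 1} : Finset ℕ)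

lemma card_kinks_le : (kinks d n).card ≤ 3 * n ^ (d - 1) := by
  rw [kinks, card_filter_coord_zero (fun z : ZMod n => z.val ∈ ({0, n / 2, n - 1} : Finset ℕ))]
  refine Nat.mul_le_mul_right _ ?_
  refine (Finset.card_le_card_of_injOn (t := ({0, n / 2, n - 1} : Finset ℕ)) ZMod.val
    (fun z hz => by simpa using hz) (ZMod.val_injective n).injOn).trans Finset.card_le_three

omit [NeZero n] in
lemma neighbour_zero (x : Vertex d n) (a : Direction d) :
    neighbour x a 0 = if a.1 = 0 then (if a.2 then x 0 + 1 else x 0 - 1) else x 0 := by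
  rcases a with ⟨i, _ | _⟩ <;> by_cases h : i = 0 <;>
    simp [neighbour, unitVec, h, eq_comm]

omit [NeZero n] in
lemma abs_height_move_sub (hn : 2 ≤ n) (c : Config d n) (x : Vertex d n) (a : Direction d) :
    |height (move c x a 0) - height (x 0)| ≤ 1 := by
  rw [move]
  split_ifs
  · rw [neighbour_zero]
    split_ifs
    exacts [abs_height_add_one_sub hn _, abs_height_sub_one_sub hn _, by simp]
  · simp

lemma move_eq_or_avg_height_eq (hn : 2 ≤ n) (c : Config d n) (x : Vertex d n)
    (hx : x ∉ kinks d n) :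
    (∃ a, move c x a = x) ∨
      avg (move c) (fun y => height (y 0)) x = height (x 0) := by
  by_cases h : ∃ a, c (edgeTo x a) ≠ true
  · obtain ⟨a, ha⟩ := h
    exact .inl ⟨a, by rw [move, if_neg ha]⟩
  · right
    push Not at h
    have hx' : (x 0).val ≠ 0 ∧ (x 0).val ≠ n / 2 ∧ (x 0).val ≠ n - 1 := by
      simpa [kinks] using hx
    have hd : (d : ℝ) ≠ 0 := by exact_mod_cast NeZero.ne d
    have hs : ∀ i : Fin d, ∑ b : Bool, height (move c x (i, b) 0) = 2 * height (x 0) := by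
      intro i
      by_cases hi : i = 0
      · simpa [move, h, neighbour_zero, hi] using
          height_add_height hn _ hx'.1 hx'.2.1 hx'.2.2
      · simp [move, h, neighbour_zero, hi, two_mul]
    rw [avg, Fintype.sum_prod_type]
    simp only [hs]
    simp
    field_simp

/-- Starting points close to the hyperplane of height `0`. -/
def slabLE (d n : ℕ) [NeZero d] [NeZero n] (a : ℝ) : Finset (Vertex d n) :=
  Finset.univ.filter fun x => height (x 0) ≤ a

/-- The slab of points of height less than `r`. -/
def slabLT (d n : ℕ) [NeZero d] [NeZero n] (r : ℝ) : Finset (Vertex d n) :=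
  Finset.univ.filter fun x => height (x 0) < r

lemma card_vertex : (Fintype.card (Vertex d n) : ℝ) = n * n ^ (d - 1) := by
  have : n ^ d = n * n ^ (d - 1) := by
    rw [← pow_succ', Nat.sub_add_cancel (NeZero.one_le)]
  rw [Fintype.card_fun, ZMod.card, Fintype.card_fin, this]
  push_cast
  rfl

lemma card_slabLT_le {r : ℝ} (hr : 0 ≤ r) :
    ((slabLT d n r).card : ℝ) ≤ (2 * r + 1) * n ^ (d - 1) := by
  rw [slabLT, card_filter_coord_zero (fun z : ZMod n => height z < r)]
  push_cast
  gcongr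
  exact card_height_lt_le hr

lemma le_card_slabLE {a : ℝ} (ha : 0 ≤ a) (han : a < n / 2) :
    a * n ^ (d - 1) ≤ ((slabLE d n a).card : ℝ) := by
  rw [slabLE, card_filter_coord_zero (fun z : ZMod n => height z ≤ a)]
  push_cast
  gcongr
  exact le_card_height_le ha han

/-- The chance that a walker who starts in the slab of height `a` leaves the slab of height `r`
within `k` steps. -/
lemma slab_loss_le (hn : 2 ≤ n) (c : ℕ → Config d n) {a r s : ℝ} (hs : 0 < s) (k : ℕ) :
    r * ((slabLE d n a).card - ∑ x ∈ slabLE d n a, (dirSeq (Direction d)).real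
        {b | Stays (fun j => move (c j)) (slabLT d n r) x b k})
      ≤ a * (slabLE d n a).card + 2 * d / (2 * s) * (slabLE d n a).card
        + k * (s / 2 * n + 3) * n ^ (d - 1) := by
  have h := killed_loss_le (m := fun j => move (c j)) (fun j => isSymm_move (c j))
    (φ := fun x : Vertex d n => height (x 0)) (fun x => abs_nonneg _)
    (fun j x b => abs_height_move_sub hn (c j) x b) (kinks d n)
    (fun j x hx => move_eq_or_avg_height_eq hn (c j) x hx)
    (slabLE d n a) (slabLT d n r) (a := a) (r := r)
    (fun x hx => by simpa [slabLE] using hx) (fun x hx => by simpa [slabLT] using hx) hs k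
  rw [← sum_real_stays (fun j => isSymm_move (c j)), card_vertex] at h
  refine h.trans ?_
  have hk : ((kinks d n).card : ℝ) ≤ 3 * n ^ (d - 1) := by
    exact_mod_cast card_kinks_le (d := d) (n := n)
  have hc : (Fintype.card (Direction d) : ℝ) = 2 * d := by
    simp [mul_comm]
  rw [hc, mul_assoc (k : ℝ)]
  gcongr
  linarith

end Slabs

/-! ### Exponential clocks -/

section Exponential

lemma measurable_ringTime (k : ℕ) : Measurable fun T : ℕ → ℝ => ringTime T k := by
  unfold ringTime
  fun_prop

lemma expMeasure_Iic {x : ℝ} (hx : 0 ≤ x) :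
    (expMeasure 1).real (Set.Iic x) = 1 - Real.exp (-x) := by
  rw [← cdf_eq_real, cdf_expMeasure_eq one_pos, if_pos hx, one_mul]

lemma ae_expSeq_nonneg : ∀ᵐ T ∂expSeq, ∀ j, 0 ≤ T j := by
  rw [ae_all_iff]
  intro j
  have h : ∀ᵐ x ∂(expMeasure 1), 0 ≤ x := by
    have h1 := expMeasure_Iic le_rfl
    rw [neg_zero, Real.exp_zero, sub_self, measureReal_eq_zero_iff] at h1
    filter_upwards [measure_eq_zero_iff_ae_notMem.1 h1] with x hx
    exact (not_le.1 hx).le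
  exact (measurePreserving_eval_infinitePi (fun _ : ℕ => expMeasure 1) j).quasiMeasurePreserving.ae h

lemma mgf_expMeasure_neg_one : ∫ x, Real.exp (-x) ∂(expMeasure 1) = 1 / 2 := by
  have h : ∫⁻ x, ENNReal.ofReal (Real.exp (-x)) ∂(expMeasure 1) = ENNReal.ofReal (1 / 2) := by
    have h2 : expMeasure 1 = volume.withDensity (exponentialPDF 1) := rfl
    have hm : ∀ r, Measurable (exponentialPDF r) := fun r =>
      (measurable_exponentialPDFReal r).ennreal_ofReal
    rw [h2, lintegral_withDensity_eq_lintegral_mul _ (hm 1) (by fun_prop)]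
    have h3 : ∀ x, (exponentialPDF 1 * fun x => ENNReal.ofReal (Real.exp (-x))) x
        = ENNReal.ofReal (1 / 2) * exponentialPDF 2 x := by
      intro x
      rw [Pi.mul_apply, exponentialPDF_eq, exponentialPDF_eq, ← ENNReal.ofReal_mul' (by positivity),
        ← ENNReal.ofReal_mul (by norm_num)]
      congr 1
      split_ifs
      · rw [one_mul, one_mul, ← Real.exp_add]
        ring_nf
      · simp
    simp_rw [h3]
    rw [lintegral_const_mul _ (hm 2), lintegral_exponentialPDF_eq_one two_pos, mul_one]
  rw [integral_eq_lintegral_of_nonneg_ae (.of_forall fun x => (Real.exp_pos _).le) (by fun_prop), h,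
    ENNReal.toReal_ofReal (by norm_num)]

lemma integrable_exp_neg_expMeasure : Integrable (fun x : ℝ => Real.exp (-x)) (expMeasure 1) := by
  by_contra h
  have := mgf_expMeasure_neg_one
  rw [integral_undef h] at this
  norm_num at this

/-- Chernoff bound for early rings. -/
lemma expSeq_ringTime_le (k : ℕ) (t : ℝ) :
    expSeq.real {T | ringTime T k ≤ t} ≤ Real.exp t * (1 / 2) ^ (k + 1) := by
  have hind : iIndepFun (fun (i : ℕ) (T : ℕ → ℝ) => T i) expSeq :=
    iIndepFun_infinitePi (X := fun _ => id) fun _ => measurable_id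
  have hmp : ∀ j : ℕ, MeasurePreserving (fun T : ℕ → ℝ => T j) expSeq (expMeasure 1) := fun j =>
    measurePreserving_eval_infinitePi (fun _ : ℕ => expMeasure 1) j
  have hi : ∀ j : ℕ, Integrable (fun T : ℕ → ℝ => Real.exp (-1 * T j)) expSeq := fun j => by
    have := (hmp j).integrable_comp_of_integrable integrable_exp_neg_expMeasure
    simpa [Function.comp_def] using this
  have hone : ∀ j : ℕ, mgf (fun T : ℕ → ℝ => T j) expSeq (-1) = 1 / 2 := fun j => by
    have := integral_map (μ := expSeq) (φ := fun T : ℕ → ℝ => T j)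
      (f := fun x : ℝ => Real.exp (-x)) (hmp j).measurable.aemeasurable
      (by rw [(hmp j).map_eq]; fun_prop)
    rw [(hmp j).map_eq, mgf_expMeasure_neg_one] at this
    rw [mgf, this]
    simp
  have hsum : (fun T : ℕ → ℝ => ringTime T k)
      = ∑ j ∈ Finset.range (k + 1), fun T : ℕ → ℝ => T j := by
    funext T
    simp [ringTime]
  have hmgf : mgf (fun T : ℕ → ℝ => ringTime T k) expSeq (-1) = (1 / 2) ^ (k + 1) := by
    rw [hsum, hind.mgf_sum (fun i => measurable_pi_apply i)]
    simp [hone]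
  have hint : Integrable (fun T : ℕ → ℝ => Real.exp (-1 * ringTime T k)) expSeq := by
    have := hind.integrable_exp_mul_sum (t := -1) (fun i => measurable_pi_apply i)
      (s := Finset.range (k + 1)) fun i _ => hi i
    simpa [ringTime] using this
  have := measure_le_le_exp_mul_mgf (μ := expSeq) (X := fun T : ℕ → ℝ => ringTime T k) t
    (t := -1) (by norm_num) hint
  rw [hmgf] at this
  simpa using this

end Exponential

/-! ### Measurability -/

section Measurability

lemma measurable_ncard_setOf {α : Type*} [MeasurableSpace α] {f : α → Set ℕ}
    (hf : ∀ k, MeasurableSet {w | k ∈ f w}) : Measurable fun w => (f w).ncard := by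
  have hF : ∀ F : Finset ℕ, MeasurableSet {w | f w = F} := by
    intro F
    have : {w | f w = F} = ⋂ k, {w | k ∈ f w ↔ k ∈ F} := by
      ext w
      simp [Set.ext_iff]
    rw [this]
    refine MeasurableSet.iInter fun k => ?_
    by_cases hk : k ∈ F
    · simpa [hk] using hf k
    · simp only [hk, iff_false]
      exact (hf k).compl
  have hpos : ∀ m ≠ 0, MeasurableSet {w | (f w).ncard = m} := by
    intro m hm
    have : {w | (f w).ncard = m} = ⋃ F : {F : Finset ℕ // F.card = m}, {w | f w = F.1} := by
      ext w
      simp only [Set.mem_ofPred_eq, Set.mem_iUnion, Subtype.exists, exists_prop]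
      constructor
      · intro h
        have hfin : (f w).Finite := Set.finite_of_ncard_ne_zero (by rwa [h])
        exact ⟨hfin.toFinset, by rw [← h, Set.ncard_eq_toFinset_card _ hfin], by simp⟩
      · rintro ⟨F, hF, h⟩
        rw [h, Set.ncard_coe_finset, hF]
    rw [this]
    exact MeasurableSet.iUnion fun F => hF _
  refine measurable_to_countable' fun m => ?_
  change MeasurableSet {w | (f w).ncard = m}
  rcases eq_or_ne m 0 with rfl | hm
  · have : {w | (f w).ncard = 0} = (⋃ m : {m : ℕ // m ≠ 0}, {w | (f w).ncard = m.1})ᶜ := by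
      ext w
      simp only [Set.mem_ofPred_eq, Set.mem_compl_iff, Set.mem_iUnion, Subtype.exists, not_exists]
      exact ⟨fun h m hm h' => hm (h'.symm.trans h), fun h => by_contra fun h0 => h _ h0 rfl⟩
    rw [this]
    exact (MeasurableSet.iUnion fun m : {m : ℕ // m ≠ 0} => hpos m.1 m.2).compl
  · exact hpos m hm

variable {d n : ℕ}

lemma measurable_env (p μ : ℝ) (ω : EnvSpace d n) : Measurable (env p μ ω) := by
  refine measurable_pi_lambda _ fun e => ?_
  have h : Measurable fun t : ℝ =>
      {k : ℕ | flipTime p μ (ω.1 e) (ω.2 e) k ≤ ENNReal.ofReal t}.ncard :=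
    measurable_ncard_setOf fun k => measurableSet_le measurable_const ENNReal.measurable_ofReal
  exact (Measurable.of_discrete (f := fun m : ℕ => not^[m] (ω.1 e))).comp h

variable [NeZero d] [NeZero n] {η : ℝ → Config d n}

omit [NeZero d] in
lemma measurable_posAfter (hη : Measurable η) (x : Vertex d n) (k : ℕ) :
    Measurable fun w : WalkSpace d => posAfter η x w k := by
  induction k with
  | zero => exact measurable_const
  | succ k ih =>
    have h1 : Measurable fun q : Config d n × Vertex d n × Direction d => move q.1 q.2.1 q.2.2 :=
      .of_discrete
    exact h1.comp ((hη.comp ((measurable_ringTime k).comp measurable_fst)).prodMk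
      (ih.prodMk ((measurable_pi_apply k).comp measurable_snd)))

omit [NeZero d] in
lemma measurable_walk (hη : Measurable η) (x : Vertex d n) (t : ℝ) : Measurable (walk η x t) := by
  have hN : Measurable fun w : WalkSpace d => {k : ℕ | ringTime w.1 k ≤ t}.ncard :=
    measurable_ncard_setOf fun k =>
      measurableSet_le ((measurable_ringTime k).comp measurable_fst) measurable_const
  have h : Measurable fun q : ℕ × WalkSpace d => posAfter η x q.2 q.1 :=
    measurable_from_prod_countable_right fun k => measurable_posAfter hη x k
  exact h.comp (hN.prodMk measurable_id)

instance : IsProbabilityMeasure (walkMeasure d) := by unfold walkMeasure; infer_instance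

lemma sum_quenchedProb (hη : Measurable η) (x : Vertex d n) (t : ℝ) (W : Finset (Vertex d n)) :
    ∑ y ∈ W, quenchedProb η x t y = (walkMeasure d).real {w | walk η x t w ∈ W} := by
  have h : {w | walk η x t w ∈ W} = ⋃ y ∈ W, {w | walk η x t w = y} := by
    ext w
    simp
  rw [h, measureReal_biUnion_finset]
  · rfl
  · intro y _ z _ hyz
    refine Set.disjoint_left.2 fun w hw hw' => hyz ?_
    exact Eq.trans (Eq.symm hw) hw'
  · exact fun y _ => measurable_walk hη x t (measurableSet_singleton y)

end Measurability

/-! ### Total variation and mixing times -/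

section TotalVariation

lemma sum_sub_sum_le_tvDist {V : Type*} [Fintype V] {f g : V → ℝ} (h : ∑ y, f y = ∑ y, g y)
    (W : Finset V) : ∑ y ∈ W, f y - ∑ y ∈ W, g y ≤ tvDist f g := by
  classical
  have h1 := Finset.sum_add_sum_compl W f
  have h2 := Finset.sum_add_sum_compl W g
  have h3 := Finset.sum_add_sum_compl W fun y => |f y - g y|
  have h4 : ∑ y ∈ W, (f y - g y) ≤ ∑ y ∈ W, |f y - g y| :=
    Finset.sum_le_sum fun _ _ => le_abs_self _
  have h5 : ∑ y ∈ Wᶜ, (g y - f y) ≤ ∑ y ∈ Wᶜ, |f y - g y| :=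
    Finset.sum_le_sum fun _ _ => by rw [abs_sub_comm]; exact le_abs_self _
  rw [Finset.sum_sub_distrib] at h4 h5
  rw [tvDist, ← h3]
  linarith

variable {d n : ℕ} [NeZero d] [NeZero n] {η : ℝ → Config d n}

lemma le_tvDist_quenchedProb (hη : Measurable η) (x : Vertex d n) (t : ℝ)
    (W : Finset (Vertex d n)) :
    (walkMeasure d).real {w | walk η x t w ∈ W} - W.card / Fintype.card (Vertex d n)
      ≤ tvDist (quenchedProb η x t) (uniformMass (Vertex d n)) := by
  have hc : (Fintype.card (Vertex d n) : ℝ) ≠ 0 := by exact_mod_cast Fintype.card_ne_zero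
  have h := sum_sub_sum_le_tvDist (f := quenchedProb η x t) (g := uniformMass (Vertex d n))
    (by rw [sum_quenchedProb hη]; simp [uniformMass]) W
  rw [sum_quenchedProb hη] at h
  simpa [uniformMass, div_eq_mul_inv] using h

lemma not_tmix_le {ε B : ℝ} (hB : 0 < B) (x : Vertex d n)
    (h : ∀ t : ℝ≥0, (t : ℝ) ≤ 2 * B → ε < tvDist (quenchedProb η x t) (uniformMass (Vertex d n))) :
    ¬ tmix ε η ≤ ENNReal.ofReal B := by
  intro hle
  have h1 : tmixFrom ε x η < ENNReal.ofReal (2 * B) :=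
    ((le_iSup (fun x => tmixFrom ε x η) x).trans hle).trans_lt
      ((ENNReal.ofReal_lt_ofReal_iff (by linarith)).2 (by linarith))
  simp only [tmixFrom, iInf_lt_iff] at h1
  obtain ⟨t, ht, hlt⟩ := h1
  refine (h t ?_).not_ge ht
  have := (ENNReal.toReal_lt_toReal ENNReal.coe_ne_top ENNReal.ofReal_ne_top).2 hlt
  rw [ENNReal.toReal_ofReal (by linarith)] at this
  exact this.le

end TotalVariation

/-! ### Slow mixing on the diffusive time scale -/

section Diffusive

variable {d n : ℕ} {η : ℝ → Config d n}

/-- The moves at the successive rings of the clock. -/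
def ringMove (η : ℝ → Config d n) (T : ℕ → ℝ) (k : ℕ) : Vertex d n → Direction d → Vertex d n :=
  move (η (ringTime T k))

lemma posAfter_eq_pathPos (η : ℝ → Config d n) (x : Vertex d n) (w : WalkSpace d) (k : ℕ) :
    posAfter η x w k = pathPos (ringMove η w.1) x w.2 k := by
  induction k with
  | zero => rfl
  | succ k ih => simp only [posAfter, pathPos, ih, ringMove]

lemma ringTime_mono {T : ℕ → ℝ} (hT : ∀ j, 0 ≤ T j) : Monotone (ringTime T) :=
  monotone_nat_of_le_succ fun k => by
    simp only [ringTime]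
    rw [Finset.sum_range_succ _ (k + 1)]
    linarith [hT (k + 1)]

lemma ncard_ringTime_le {T : ℕ → ℝ} (hT : ∀ j, 0 ≤ T j) {t : ℝ} {k : ℕ} (h : t < ringTime T k) :
    {k : ℕ | ringTime T k ≤ t}.ncard ≤ k := by
  have hsub : {k : ℕ | ringTime T k ≤ t} ⊆ (Finset.range k : Set ℕ) := by
    intro j hj
    by_contra hjk
    have hkj : k ≤ j := by simpa using hjk
    exact (h.trans_le (ringTime_mono hT hkj)).not_ge hj
  refine (Set.ncard_le_ncard hsub (Finset.finite_toSet _)).trans (le_of_eq ?_)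
  rw [Set.ncard_coe_finset, Finset.card_range]

lemma walk_mem_of_stays {U : Finset (Vertex d n)} {x : Vertex d n} (hx : x ∈ U) {w : WalkSpace d}
    (hT : ∀ j, 0 ≤ w.1 j) {k : ℕ} (hs : Stays (ringMove η w.1) U x w.2 k) {t : ℝ}
    (ht : t < ringTime w.1 k) : walk η x t w ∈ U := by
  have hN := ncard_ringTime_le hT ht
  rw [walk, posAfter_eq_pathPos]
  rcases h : {k : ℕ | ringTime w.1 k ≤ t}.ncard with _ | j
  · exact hx
  · exact hs j (by omega)

variable [NeZero d] [NeZero n]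

omit [NeZero d] in
lemma measurableSet_stays (hη : Measurable η) (U : Finset (Vertex d n)) (x : Vertex d n) (k : ℕ) :
    MeasurableSet {w : WalkSpace d | Stays (ringMove η w.1) U x w.2 k} := by
  have : {w : WalkSpace d | Stays (ringMove η w.1) U x w.2 k}
      = ⋂ j : Fin k, {w | posAfter η x w (j + 1) ∈ (U : Set (Vertex d n))} := by
    ext w
    simp only [Stays, Set.mem_ofPred_eq, Set.mem_iInter, posAfter_eq_pathPos, Finset.mem_coe]
    exact ⟨fun h j => h j j.2, fun h j hj => h ⟨j, hj⟩⟩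
  rw [this]
  exact MeasurableSet.iInter fun j => measurable_posAfter hη x _ (Set.toFinite _).measurableSet

lemma le_sum_stays (hη : Measurable η) (A U : Finset (Vertex d n)) (k : ℕ) {b : ℝ}
    (h : ∀ T : ℕ → ℝ, b ≤ ∑ x ∈ A, (dirSeq (Direction d)).real {a | Stays (ringMove η T) U x a k}) :
    b ≤ ∑ x ∈ A, (walkMeasure d).real {w | Stays (ringMove η w.1) U x w.2 k} := by
  have h0 : 0 ≤ ∑ x ∈ A, (walkMeasure d).real {w | Stays (ringMove η w.1) U x w.2 k} :=
    Finset.sum_nonneg fun _ _ => measureReal_nonneg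
  rw [← ENNReal.ofReal_le_ofReal_iff h0, ENNReal.ofReal_sum_of_nonneg fun _ _ => measureReal_nonneg]
  simp only [measureReal_def, ENNReal.ofReal_toReal (measure_ne_top _ _)]
  have hm := fun x => measurableSet_stays hη U x k
  have hp : ∀ x, walkMeasure d {w | Stays (ringMove η w.1) U x w.2 k}
      = ∫⁻ T, dirSeq (Direction d) {a | Stays (ringMove η T) U x a k} ∂expSeq := fun x => by
    rw [walkMeasure, Measure.prod_apply (hm x)]
    rfl
  simp only [hp]
  have hmT : ∀ x, Measurable fun T : ℕ → ℝ =>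
      dirSeq (Direction d) {a | Stays (ringMove η T) U x a k} := fun x =>
    measurable_measure_prodMk_left (hm x)
  rw [← lintegral_finsetSum _ fun x _ => hmT x]
  calc ENNReal.ofReal b = ∫⁻ _T, ENNReal.ofReal b ∂expSeq := by simp
    _ ≤ _ := lintegral_mono fun T => by
      refine (ENNReal.ofReal_le_ofReal (h T)).trans (le_of_eq ?_)
      rw [ENNReal.ofReal_sum_of_nonneg fun _ _ => measureReal_nonneg]
      simp only [measureReal_def, ENNReal.ofReal_toReal (measure_ne_top _ _)]

/-- Some walker close to height `0` is unlikely to leave the slab of height `r` soon. -/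
lemma exists_le_stays (hη : Measurable η) (hn : 2 ≤ n) {a r s : ℝ} (ha : 0 < a) (han : a < n / 2)
    (hr : 0 < r) (hs : 0 < s) (k : ℕ) :
    ∃ x ∈ slabLE d n a, 1 - (a / r + d / (s * r) + k * (s / 2 * n + 3) / (r * a))
      ≤ (walkMeasure d).real {w | Stays (ringMove η w.1) (slabLT d n r) x w.2 k} := by
  set A := slabLE d n a with hA
  have hpow : (0 : ℝ) < n ^ (d - 1) := by
    have : (0 : ℝ) < n := by exact_mod_cast (by omega : 0 < n)
    positivity
  have hAcard : a * n ^ (d - 1) ≤ A.card := le_card_slabLE ha.le han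
  have hApos : (0 : ℝ) < A.card := (mul_pos ha hpow).trans_le hAcard
  have hne : A.Nonempty := Finset.card_pos.1 (by exact_mod_cast hApos)
  have hsum := le_sum_stays hη A (slabLT d n r) k
    (b := A.card * (1 - (a / r + d / (s * r) + k * (s / 2 * n + 3) / (r * a)))) fun T => by
      have h := slab_loss_le hn (fun j => η (ringTime T j)) (a := a) (r := r) hs k
      set F := ∑ x ∈ slabLE d n a, (dirSeq (Direction d)).real
        {b | Stays (fun j => move (η (ringTime T j))) (slabLT d n r) x b k} with hF
      change _ ≤ F
      have h2 : k * (s / 2 * n + 3) * n ^ (d - 1) ≤ k * (s / 2 * n + 3) / a * A.card := by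
        calc k * (s / 2 * n + 3) * (n : ℝ) ^ (d - 1)
            = k * (s / 2 * n + 3) / a * (a * n ^ (d - 1)) := by field_simp
          _ ≤ _ := by gcongr
      have h3 : r * (A.card - F) ≤ r * (A.card *
          (a / r + d / (s * r) + k * (s / 2 * n + 3) / (r * a))) := by
        rw [← hA] at h
        refine (h.trans (add_le_add_right h2 _)).trans (le_of_eq ?_)
        field_simp
      have h4 := le_of_mul_le_mul_left h3 hr
      linarith
  rw [← nsmul_eq_mul, ← Finset.sum_const] at hsum
  exact Finset.exists_le_of_sum_le hne hsum

/-- In every environment, the quenched law of some walker is far from uniform up to a time of order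
`n ^ 2`. -/
lemma exists_lt_tvDist {ε : ℝ} (d : ℕ) [NeZero d] (hε0 : 0 < ε) (hε1 : ε < 1) :
    ∃ β : ℝ, 0 < β ∧ ∃ n₀ : ℕ, ∀ (n : ℕ) [NeZero n], n₀ ≤ n → ∀ η : ℝ → Config d n,
      Measurable η → ∃ x : Vertex d n, ∀ t : ℝ, t ≤ 2 * (β * (n : ℝ) ^ 2) →
        ε < tvDist (quenchedProb η x t) (uniformMass (Vertex d n)) := by
  obtain ⟨κ, hκ⟩ : ∃ κ, κ = (1 - ε) / 4 := ⟨_, rfl⟩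
  have hκ0 : 0 < κ := by rw [hκ]; linarith
  have hκ1 : κ < 1 := by rw [hκ]; linarith
  have hd : (0 : ℝ) < d := by exact_mod_cast NeZero.pos d
  obtain ⟨S, hS⟩ : ∃ S : ℝ, S = 12 * d / κ ^ 2 := ⟨_, rfl⟩
  have hS0 : 0 < S := by rw [hS]; positivity
  obtain ⟨γ, hγ⟩ : ∃ γ : ℝ, γ = κ ^ 4 / (144 * (S / 2 + 3)) := ⟨_, rfl⟩
  have hγ0 : 0 < γ := by rw [hγ]; positivity
  refine ⟨γ / 8, by positivity, ⌈4 / (γ * κ)⌉₊ + ⌈2 / κ⌉₊ + 2, fun n _ hn η hη => ?_⟩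
  have hn2 : 2 ≤ n := by omega
  have hnR : (2 : ℝ) ≤ n := by exact_mod_cast hn2
  have hn0 : (0 : ℝ) < n := by linarith
  have hn1 : 4 / (γ * κ) ≤ n := (Nat.le_ceil _).trans (by exact_mod_cast (by omega))
  have hn3 : 2 / κ ≤ n := (Nat.le_ceil _).trans (by exact_mod_cast (by omega))
  set r : ℝ := κ * n / 4 with hr
  set a : ℝ := κ ^ 2 * n / 12 with ha
  set s : ℝ := S / n with hs
  set k : ℕ := ⌊γ * n ^ 2⌋₊ with hk
  have hr0 : 0 < r := by positivity
  have ha0 : 0 < a := by positivity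
  have hs0 : 0 < s := by positivity
  have har : a < r := by
    rw [ha, hr]
    nlinarith [mul_pos hκ0 hn0]
  have han : a < n / 2 := by
    rw [ha]
    nlinarith [mul_pos hκ0 hn0]
  obtain ⟨x, hxA, hx⟩ := exists_le_stays hη hn2 ha0 han hr0 hs0 k
  have hxU : x ∈ slabLT d n r := by
    simp only [slabLE, slabLT, Finset.mem_filter, Finset.mem_univ, true_and] at hxA ⊢
    exact hxA.trans_lt har
  have hloss : a / r + d / (s * r) + k * (s / 2 * n + 3) / (r * a) ≤ κ := by
    have h1 : a / r = κ / 3 := by rw [ha, hr]; field_simp; norm_num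
    have h2 : d / (s * r) = κ / 3 := by rw [hs, hr, hS]; field_simp; norm_num
    have h3 : k * (s / 2 * n + 3) / (r * a) ≤ κ / 3 := by
      have hk1 : (k : ℝ) ≤ γ * n ^ 2 := Nat.floor_le (by positivity)
      have h4 : s / 2 * n + 3 = S / 2 + 3 := by rw [hs]; field_simp
      rw [h4]
      calc k * (S / 2 + 3) / (r * a) ≤ γ * n ^ 2 * (S / 2 + 3) / (r * a) := by gcongr
        _ = κ / 3 := by rw [hγ, hr, ha]; field_simp; norm_num
    linarith
  refine ⟨x, fun t ht => ?_⟩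
  have hlate : expSeq.real {T | ringTime T k ≤ t} ≤ κ := by
    refine (expSeq_ringTime_le k t).trans ?_
    have h1 : γ * n ^ 2 ≤ ((k + 1 : ℕ) : ℝ) := by
      push_cast
      exact (Nat.lt_floor_add_one _).le
    have h2 : (1 / 2 : ℝ) ≤ Real.exp (-(1 / 2)) := by
      have := Real.add_one_le_exp (-(1 / 2) : ℝ)
      linarith
    have h3 : (1 / 2 : ℝ) ^ (k + 1) ≤ Real.exp (-(γ * n ^ 2 / 2)) := by
      calc (1 / 2 : ℝ) ^ (k + 1) ≤ Real.exp (-(1 / 2)) ^ (k + 1) := by gcongr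
        _ = Real.exp (((k + 1 : ℕ) : ℝ) * -(1 / 2)) := (Real.exp_nat_mul _ _).symm
        _ ≤ _ := Real.exp_le_exp.2 (by linarith)
    calc Real.exp t * (1 / 2) ^ (k + 1)
        ≤ Real.exp (2 * (γ / 8 * n ^ 2)) * Real.exp (-(γ * n ^ 2 / 2)) := by gcongr
      _ = (Real.exp (γ * n ^ 2 / 4))⁻¹ := by
        rw [← Real.exp_add, ← Real.exp_neg]
        ring_nf
      _ ≤ (γ * n ^ 2 / 4)⁻¹ := by
        gcongr
        linarith [Real.add_one_le_exp (γ * n ^ 2 / 4)]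
      _ ≤ κ := by
        rw [inv_le_comm₀ (by positivity) hκ0]
        rw [div_le_iff₀ (by positivity)] at hn1
        rw [inv_le_iff_one_le_mul₀ hκ0]
        nlinarith [mul_pos (mul_pos hγ0 hκ0) hn0]
  have hmem : (walkMeasure d).real {w | Stays (ringMove η w.1) (slabLT d n r) x w.2 k}
      ≤ (walkMeasure d).real {w | walk η x t w ∈ slabLT d n r}
        + expSeq.real {T | ringTime T k ≤ t} := by
    have hmp : MeasurePreserving Prod.fst (walkMeasure d) expSeq := measurePreserving_fst
    have h1 : expSeq.real {T | ringTime T k ≤ t}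
        = (walkMeasure d).real {w | ringTime w.1 k ≤ t} := by
      rw [measureReal_def, measureReal_def, ← hmp.measure_preimage
        (measurableSet_le (measurable_ringTime k) measurable_const).nullMeasurableSet]
      rfl
    rw [h1]
    refine le_trans ?_ (measureReal_union_le _ _)
    refine ENNReal.toReal_mono (measure_ne_top _ _) (measure_mono_ae ?_)
    filter_upwards [hmp.quasiMeasurePreserving.ae ae_expSeq_nonneg] with w hw hstay
    rcases le_or_gt (ringTime w.1 k) t with h | h
    · exact .inr h
    · exact .inl (walk_mem_of_stays hxU hw hstay h)
  have hvol : (slabLT d n r).card / (Fintype.card (Vertex d n) : ℝ) ≤ κ := by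
    rw [card_vertex, div_le_iff₀ (by positivity)]
    refine (card_slabLT_le hr0.le).trans ?_
    rw [← mul_assoc]
    gcongr
    rw [div_le_iff₀ hκ0] at hn3
    rw [hr]
    linarith
  have := le_tvDist_quenchedProb hη x t (slabLT d n r)
  have : ε = 1 - 4 * κ := by rw [hκ]; ring
  linarith

end Diffusive

/-! ### Independent blocks of coordinates -/

section Blocks

variable {ι Ω : Type*} [Fintype ι] [MeasurableSpace Ω] (μ : Measure Ω) [IsProbabilityMeasure μ]

lemma pi_real_forall_mem (S : Finset ι) (G : Set Ω) :
    (Measure.pi fun _ : ι => μ).real {ω | ∀ e ∈ S, ω e ∈ G} = μ.real G ^ S.card := by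
  classical
  have h : {ω : ι → Ω | ∀ e ∈ S, ω e ∈ G}
      = Set.univ.pi fun e => if e ∈ S then G else Set.univ := by
    ext ω
    simp only [Set.mem_ofPred_eq, Set.mem_univ_pi]
    refine forall_congr' fun e => ?_
    by_cases he : e ∈ S <;> simp [he]
  rw [h, measureReal_def, Measure.pi_pi, ENNReal.toReal_prod,
    ← Finset.prod_subset (Finset.subset_univ S) fun e _ he => by simp [he],
    Finset.prod_congr rfl (g := fun _ => μ.real G) fun e he => by simp [he, measureReal_def],
    Finset.prod_const]

/-- If every coordinate is good with probability `μ G`, then it is unlikely that each of many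
disjoint blocks contains a bad coordinate. -/
lemma pi_real_forall_exists_notMem_le {G : Set Ω} (hG : MeasurableSet G) {S : ℕ → Finset ι} {L : ℕ}
    (hL : ∀ j, (S j).card ≤ L) (m : ℕ) (hS : ∀ j < m, ∀ i < j, Disjoint (S i) (S j)) :
    (Measure.pi fun _ : ι => μ).real {ω | ∀ j < m, ∃ e ∈ S j, ω e ∉ G}
      ≤ (1 - μ.real G ^ L) ^ m := by
  classical
  have hGc : ∀ {κ : Type _} (e : κ), MeasurableSet {r : κ → Ω | r e ∉ G} := fun e =>
    (measurable_pi_apply e hG).compl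
  induction m with
  | zero => simp
  | succ m ih =>
    set T := (Finset.range m).biUnion S with hT
    have hdisj : Disjoint T (S m) := by
      rw [hT, Finset.disjoint_biUnion_left]
      exact fun i hi => hS m m.lt_succ_self i (Finset.mem_range.1 hi)
    have hind : iIndepFun (fun (i : ι) (ω : ι → Ω) => ω i) (Measure.pi fun _ : ι => μ) :=
      iIndepFun_pi (X := fun _ => id) fun _ => aemeasurable_id
    have hi := hind.indepFun_finset T (S m) hdisj fun i => measurable_pi_apply i
    set P : Set (T → Ω) := ⋂ j ∈ Finset.range m, ⋃ e ∈ Finset.univ.filter fun e : T => e.1 ∈ S j,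
      {r | r e ∉ G} with hP
    set Q : Set (S m → Ω) := ⋃ e, {r | r e ∉ G} with hQ
    have hPm : MeasurableSet P :=
      Finset.measurableSet_biInter _ fun j _ => Finset.measurableSet_biUnion _ fun e _ => hGc e
    have hQm : MeasurableSet Q := MeasurableSet.iUnion fun e => hGc e
    have h1 : {ω : ι → Ω | ∀ j < m, ∃ e ∈ S j, ω e ∉ G}
        = (fun (ω : ι → Ω) (i : T) => ω i) ⁻¹' P := by
      ext ω
      simp only [hP, Set.mem_ofPred_eq, Set.mem_preimage, Set.mem_iInter, Set.mem_iUnion,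
        Finset.mem_range, Finset.mem_filter, Finset.mem_univ, true_and, exists_prop]
      refine forall₂_congr fun j hj => ⟨?_, ?_⟩
      · rintro ⟨e, he, h⟩
        exact ⟨⟨e, Finset.mem_biUnion.2 ⟨j, Finset.mem_range.2 hj, he⟩⟩, he, h⟩
      · rintro ⟨e, he, h⟩
        exact ⟨e, he, h⟩
    have h2 : {ω : ι → Ω | ∀ e ∈ S m, ω e ∈ G}ᶜ = (fun (ω : ι → Ω) (i : S m) => ω i) ⁻¹' Q := by
      ext ω
      simp [hQ]
    have h3 : {ω : ι → Ω | ∀ j < m + 1, ∃ e ∈ S j, ω e ∉ G}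
        = {ω : ι → Ω | ∀ j < m, ∃ e ∈ S j, ω e ∉ G} ∩ {ω : ι → Ω | ∀ e ∈ S m, ω e ∈ G}ᶜ := by
      ext ω
      simp only [Set.mem_ofPred_eq, Set.mem_inter_iff, Set.mem_compl_iff, not_forall, exists_prop,
        Nat.lt_succ_iff_lt_or_eq]
      constructor
      · exact fun h => ⟨fun j hj => h j (.inl hj), h m (.inr rfl)⟩
      · rintro ⟨h, h'⟩ j (hj | rfl)
        exacts [h j hj, h']
    have hms : MeasurableSet {ω : ι → Ω | ∀ e ∈ S m, ω e ∈ G} := by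
      rw [← compl_compl {ω : ι → Ω | ∀ e ∈ S m, ω e ∈ G}, h2]
      exact (measurable_pi_lambda _ (fun i : S m => measurable_pi_apply i.1) hQm).compl
    have hq0 : 0 ≤ μ.real G := measureReal_nonneg
    have hq1 : μ.real G ≤ 1 := measureReal_le_one
    have h4 : (Measure.pi fun _ : ι => μ).real {ω : ι → Ω | ∀ e ∈ S m, ω e ∈ G}ᶜ
        ≤ 1 - μ.real G ^ L := by
      rw [probReal_compl_eq_one_sub hms, pi_real_forall_mem]
      linarith [pow_le_pow_of_le_one hq0 hq1 (hL m)]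
    rw [h3, h1, h2, measureReal_def, hi.measure_inter_preimage_eq_mul _ _ hPm hQm,
      ENNReal.toReal_mul, ← measureReal_def, ← measureReal_def, ← h1, ← h2, pow_succ]
    exact mul_le_mul (ih fun j hj => hS j (hj.trans m.lt_succ_self)) h4 measureReal_nonneg
      (pow_nonneg (by linarith [pow_le_one₀ (n := L) hq0 hq1]) _)

end Blocks

/-! ### Walkers that are stuck -/

section Stuck

variable {d n : ℕ}

lemma env_eq_false {p μ β : ℝ} (hp0 : 0 ≤ p) (hp1 : p < 1) (hμ : 0 < μ) (hβ : 0 < β)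
    {ω : EnvSpace d n} {e : Edge d n} (h1 : ω.1 e = false) (h2 : 2 * β < ω.2 e 0) {t : ℝ}
    (ht : t ≤ 2 * (β / μ)) : env p μ ω t e = false := by
  have hempty : {k : ℕ | flipTime p μ (ω.1 e) (ω.2 e) k ≤ ENNReal.ofReal t} = ∅ := by
    rw [Set.eq_empty_iff_forall_notMem]
    intro k hk
    have h3 : holdingTime p μ (ω.1 e) (ω.2 e) 0 ≤ ENNReal.ofReal t :=
      le_trans (Finset.single_le_sum (f := holdingTime p μ (ω.1 e) (ω.2 e))
        (fun _ _ => zero_le) (Finset.mem_range.2 k.succ_pos)) hk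
    refine h3.not_gt ?_
    rw [holdingTime, h1, ENNReal.lt_div_iff_mul_lt (.inr ENNReal.ofReal_ne_top)
      (.inl ENNReal.ofReal_ne_top)]
    change ENNReal.ofReal t * ENNReal.ofReal (p * μ) < _
    rw [← ENNReal.ofReal_mul' (by positivity), ENNReal.ofReal_lt_ofReal_iff (by linarith)]
    calc t * (p * μ) ≤ 2 * (β / μ) * (p * μ) := by gcongr
      _ = 2 * β * p := by field_simp
      _ ≤ 2 * β := by nlinarith
      _ < _ := h2
  rw [env, edgeState, hempty, Set.ncard_empty, h1]
  rfl

lemma walk_eq_of_closed {η : ℝ → Config d n} {x : Vertex d n} {t : ℝ}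
    (h : ∀ s ≤ t, ∀ a, η s (edgeTo x a) = false) {w : WalkSpace d} (hT : ∀ j, 0 ≤ w.1 j) :
    walk η x t w = x := by
  have key : ∀ k ≤ {k : ℕ | ringTime w.1 k ≤ t}.ncard, posAfter η x w k = x := by
    intro k
    induction k with
    | zero => exact fun _ => rfl
    | succ k ih =>
      intro hk
      have hle : ringTime w.1 k ≤ t := by
        by_contra hlt
        have := ncard_ringTime_le hT (not_le.1 hlt)
        omega
      rw [posAfter, ih (by omega), move, h _ hle]
      simp
  exact key _ le_rfl

/-- The edges at `x`. -/
def star (x : Vertex d n) : Finset (Edge d n) := Finset.univ.image (edgeTo x)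

lemma card_star_le (x : Vertex d n) : (star x).card ≤ 2 * d :=
  Finset.card_image_le.trans (by simp [mul_comm])

lemma edgeTo_fst_zero [NeZero d] (x : Vertex d n) (a : Direction d) :
    (edgeTo x a).1 0 = x 0 ∨ (edgeTo x a).1 0 = x 0 - 1 := by
  rcases a with ⟨i, _ | _⟩
  · by_cases h : i = 0
    · right; simp [edgeTo, unitVec, h]
    · left; simp [edgeTo, unitVec, Ne.symm h]
  · left; rfl

/-- Every other vertex on a coordinate axis. -/
def axisVertex (d n : ℕ) [NeZero d] (j : ℕ) : Vertex d n := Pi.single 0 ((2 * j : ℕ) : ZMod n)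

variable [NeZero d] [NeZero n]

omit [NeZero n] in
lemma disjoint_star {i j : ℕ} (hij : i < j) (hj : j < n / 2) :
    Disjoint (star (axisVertex d n i)) (star (axisVertex d n j)) := by
  have hne : ∀ k l : ℕ, k < n → l < n → k ≠ l → (k : ZMod n) ≠ l := by
    intro k l hk hl hkl h
    rw [ZMod.natCast_eq_natCast_iff', Nat.mod_eq_of_lt hk, Nat.mod_eq_of_lt hl] at h
    exact hkl h
  rw [Finset.disjoint_left]
  intro e hi hj'
  simp only [star, Finset.mem_image, Finset.mem_univ, true_and] at hi hj'
  obtain ⟨a, rfl⟩ := hi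
  obtain ⟨b, hb⟩ := hj'
  have h0 := hne (2 * i) (2 * j) (by omega) (by omega) (by omega)
  have h1 := hne (2 * i + 1) (2 * j) (by omega) (by omega) (by omega)
  have h2 := hne (2 * i) (2 * j + 1) (by omega) (by omega) (by omega)
  rw [Nat.cast_add _ 1, Nat.cast_one] at h1 h2
  have hb0 : (edgeTo (axisVertex d n j) b).1 0 = (edgeTo (axisVertex d n i) a).1 0 := by rw [hb]
  have hv : ∀ k, axisVertex d n k 0 = ((2 * k : ℕ) : ZMod n) := fun k => by simp [axisVertex]
  rcases edgeTo_fst_zero (axisVertex d n i) a with ha | ha <;>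
    rcases edgeTo_fst_zero (axisVertex d n j) b with hb' | hb' <;>
    rw [ha, hb', hv, hv] at hb0
  · exact h0 hb0.symm
  · exact h1 (by rw [← hb0, sub_add_cancel])
  · exact h2 (by rw [hb0, sub_add_cancel])
  · exact h0 (sub_left_injective hb0).symm

/-- A walker at a vertex whose edges stay closed is far from equilibrium. -/
lemma not_tmix_env_le {ε p μ β : ℝ} (hp0 : 0 ≤ p) (hp1 : p < 1) (hμ : 0 < μ)
    (hβ : 0 < β) (hn : 1 / (1 - ε) < n) (hε1 : ε < 1) {ω : EnvSpace d n} (x : Vertex d n)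
    (h : ∀ e ∈ star x, ω.1 e = false ∧ 2 * β < ω.2 e 0) :
    ¬ tmix ε (env p μ ω) ≤ ENNReal.ofReal (β / μ) := by
  refine not_tmix_le (by positivity) x fun t ht => ?_
  have h1 : (walkMeasure d).real {w | walk (env p μ ω) x t w ∈ ({x} : Finset (Vertex d n))} = 1 := by
    have hmp : MeasurePreserving Prod.fst (walkMeasure d) expSeq := measurePreserving_fst
    rw [measureReal_def, measure_congr (Filter.eventuallyEq_univ.2 ?_), measure_univ,
      ENNReal.toReal_one]
    filter_upwards [hmp.quasiMeasurePreserving.ae ae_expSeq_nonneg] with w hw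
    refine Finset.mem_singleton.2 (walk_eq_of_closed (fun s hs a => ?_) hw)
    have he := h _ (Finset.mem_image_of_mem (edgeTo x) (Finset.mem_univ a))
    exact env_eq_false hp0 hp1 hμ hβ he.1 he.2 (hs.trans ht)
  have h2 := le_tvDist_quenchedProb (measurable_env p μ ω) x t {x}
  rw [h1, Finset.card_singleton, Nat.cast_one] at h2
  have h3 : (n : ℝ) ≤ Fintype.card (Vertex d n) := by
    rw [card_vertex]
    have : (1 : ℝ) ≤ n := by exact_mod_cast NeZero.one_le
    exact le_mul_of_one_le_right (by linarith) (one_le_pow₀ this)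
  have h4 : 1 / (Fintype.card (Vertex d n) : ℝ) < 1 - ε := by
    rw [one_div_lt _ (by linarith)]
    · exact hn.trans_le h3
    · exact_mod_cast Fintype.card_pos
  linarith

end Stuck

/-! ### Slow mixing on the time scale of the environment -/

section SlowEnvironment

lemma isProbabilityMeasure_bernoulliLaw {p : ℝ} (hp0 : 0 ≤ p) (hp1 : p ≤ 1) :
    IsProbabilityMeasure (bernoulliLaw p) := by
  refine ⟨?_⟩
  rw [bernoulliLaw, Measure.add_apply, Measure.smul_apply, Measure.smul_apply, measure_univ,
    measure_univ, ENNReal.smul_def, ENNReal.smul_def, smul_eq_mul, smul_eq_mul, mul_one, mul_one,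
    ← ENNReal.coe_add, ← Real.toNNReal_add hp0 (by linarith)]
  simp

/-- The states and first clocks of edges that remain closed for a long time. -/
def lazyEdge (β : ℝ) : Set (Bool × (ℕ → ℝ)) := {false} ×ˢ {T | 2 * β < T 0}

lemma measurableSet_lazyEdge (β : ℝ) : MeasurableSet (lazyEdge β) :=
  (measurableSet_singleton _).prod (measurableSet_lt measurable_const (measurable_pi_apply 0))

lemma lazyEdge_pos {p β : ℝ} (hp1 : p < 1) (hβ : 0 < β) :
    0 < ((bernoulliLaw p).prod expSeq).real (lazyEdge β) := by
  have h1 : (bernoulliLaw p).real {false} = 1 - p := by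
    simp [measureReal_def, bernoulliLaw, hp1.le]
  have h2 : expSeq.real {T | 2 * β < T 0} = Real.exp (-(2 * β)) := by
    have hmp := measurePreserving_eval_infinitePi (fun _ : ℕ => expMeasure 1) 0
    have h3 : expSeq.real {T | 2 * β < T 0} = (expMeasure 1).real (Set.Iic (2 * β))ᶜ := by
      rw [measureReal_def, measureReal_def,
        ← hmp.measure_preimage measurableSet_Iic.compl.nullMeasurableSet]
      congr 2
      ext T
      simp
    rw [h3, probReal_compl_eq_one_sub measurableSet_Iic, expMeasure_Iic (by linarith)]
    ring
  rw [lazyEdge, measureReal_prod_prod, h1, h2]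
  exact mul_pos (by linarith) (Real.exp_pos _)

/-- The environment as a family of independent edges. -/
lemma measurePreserving_env (d n : ℕ) [NeZero n] {p : ℝ} [IsProbabilityMeasure (bernoulliLaw p)] :
    MeasurePreserving (MeasurableEquiv.arrowProdEquivProdArrow Bool (ℕ → ℝ) (Edge d n))
      (Measure.pi fun _ => (bernoulliLaw p).prod expSeq) (envMeasure d n p) :=
  measurePreserving_arrowProdEquivProdArrow _ _ _ _ _

lemma envMeasure_tmix_le {d : ℕ} [NeZero d] {ε p M β : ℝ} (hε1 : ε < 1) (hp0 : 0 ≤ p)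
    (hp1 : p < 1) (hM : 0 < M) (hβ : 0 < β) :
    ∃ n₀ : ℕ, ∀ (n : ℕ) [NeZero n], n₀ ≤ n → ∀ μ : ℝ, 0 < μ →
      envMeasure d n p {ω | tmix ε (env p μ ω) ≤ ENNReal.ofReal (β / μ)}
        ≤ ENNReal.ofReal (1 / M) := by
  have := isProbabilityMeasure_bernoulliLaw hp0 hp1.le
  set q := ((bernoulliLaw p).prod expSeq).real (lazyEdge β) with hq
  have hq0 : 0 < q ^ (2 * d) := pow_pos (lazyEdge_pos hp1 hβ) _
  have hq1 : q ^ (2 * d) ≤ 1 := pow_le_one₀ measureReal_nonneg measureReal_le_one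
  obtain ⟨m, hm⟩ := exists_pow_lt_of_lt_one (one_div_pos.2 hM)
    (show 1 - q ^ (2 * d) < 1 by linarith)
  refine ⟨2 * m + ⌊1 / (1 - ε)⌋₊ + 1, fun n _ hn μ hμ => ?_⟩
  have hnε : 1 / (1 - ε) < n := (Nat.lt_floor_add_one _).trans_le (by exact_mod_cast (by omega))
  have hsub : {ω : EnvSpace d n | tmix ε (env p μ ω) ≤ ENNReal.ofReal (β / μ)} ⊆
      {ω | ∀ j < m, ∃ e ∈ star (axisVertex d n j), (ω.1 e, ω.2 e) ∉ lazyEdge β} := by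
    intro ω hω j _
    by_contra hcon
    push Not at hcon
    exact not_tmix_env_le hp0 hp1 hμ hβ hnε hε1 (axisVertex d n j) hcon hω
  refine (measure_mono hsub).trans ?_
  rw [← (measurePreserving_env d n (p := p)).measure_preimage_equiv, ← ofReal_measureReal]
  refine ENNReal.ofReal_le_ofReal (le_trans ?_ hm.le)
  exact pi_real_forall_exists_notMem_le _ (measurableSet_lazyEdge β)
    (fun j => card_star_le (axisVertex d n j)) m fun j hj i hij => disjoint_star hij (by omega)

end SlowEnvironment

end DynPerc

end

theorem proposition1p6 (d : ℕ) [NeZero d] (ε : ℝ) (hε0 : 0 < ε) (hε1 : ε < 1)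
    (p : ℝ) (hp0 : 0 ≤ p) (hp1 : p < 1) (M : ℝ) (hM : 0 < M) :
    ∃ β : ℝ, 0 < β ∧ ∃ n₀ : ℕ, 0 < n₀ ∧
      ∀ (n : ℕ) [NeZero n], n₀ ≤ n → ∀ μ : ℝ, 0 < μ → μ ≤ 1 / 2 →
        DynPerc.envMeasure d n p
            {ω | DynPerc.tmix ε (DynPerc.env p μ ω) ≤ ENNReal.ofReal (β * (n : ℝ) ^ 2)}
          ≤ ENNReal.ofReal (1 / M) ∧
        DynPerc.envMeasure d n p
            {ω | DynPerc.tmix ε (DynPerc.env p μ ω) ≤ ENNReal.ofReal (β / μ)}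
          ≤ ENNReal.ofReal (1 / M) := by
  obtain ⟨β, hβ, n₁, h₁⟩ := DynPerc.exists_lt_tvDist d hε0 hε1
  obtain ⟨n₂, h₂⟩ := DynPerc.envMeasure_tmix_le (d := d) hε1 hp0 hp1 hM hβ
  refine ⟨β, hβ, n₁ + n₂ + 1, by omega, fun n _ hn μ hμ _ => ⟨?_, h₂ n (by omega) μ hμ⟩⟩
  have hn0 : (0 : ℝ) < n := by exact_mod_cast (by omega : 0 < n)
  have hempty : {ω : DynPerc.EnvSpace d n |
      DynPerc.tmix ε (DynPerc.env p μ ω) ≤ ENNReal.ofReal (β * (n : ℝ) ^ 2)} = ∅ := by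
    rw [Set.eq_empty_iff_forall_notMem]
    intro ω
    obtain ⟨x, hx⟩ := h₁ n (by omega) _ (DynPerc.measurable_env p μ ω)
    exact DynPerc.not_tmix_le (by positivity) x fun t ht => hx t ht
  rw [hempty, measure_empty]
  exact zero_le
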